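/- Let $n\ge 2$ be an integer, let $\Omega\subset\mathbb R^n$ be a bounded open set, let $1<p<n$, $p'=\frac{p}{p-1}$, $0<\alpha<\frac1{p'}$, and set $q=\frac{np(1-\alpha)}{n-\alpha p}$ (so that $1<q<p$). Let $b:\Omega\to\mathbb R$ be a measurable function with $0<\beta_2\le b(x)\le\beta_3<+\infty$ for almost every $x\in\Omega$, let $\beta_1>0$, and let $a:\Omega\times\mathbb R\to\mathbb R$ satisfy, for almost every $x\in\Omega$ and every $s\in\mathbb R$, $$a(x,s)=\frac{\beta_1}{(b(x)+|s|)^{\alpha p}}.$$ Let $j:\mathbb R^n\to\mathbb R$ be a convex function with $j(0)=0$ and $\beta_4|\xi|^p\le j(\xi)\le\beta_5(1+|\xi|^p)$ for every $\xi\in\mathbb R^n$, where $\beta_4,\beta_5>0$. Let $r\ge \frac np$ and let $f$ belong to the Marcinkiewicz space $M^r(\Omega)$, that is, $f:\Omega\to\mathbb R$ is measurable and there is a constant $c>0$ with $|\{x\in\Omega:|f(x)|>t\}|\le c\,t^{-r}$ for every $t>0$. For $v\in W_0^{1,q}(\Omega)$ put $$\mathcal J(v)=\int_\Omega a(x,v)\,j(\nabla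 v)\,dx-\int_\Omega f v\,dx,\qquad \mathcal I(v)=\begin{cases}\mathcal J(v)&\text{if }\mathcal J(v)\text{ is finite},\\+\infty&\text{otherwise},\end{cases}$$ where $\mathcal J(v)$ is finite means that both integrands are integrable on $\Omega$. Let $u\in W_0^{1,q}(\Omega)$ be a minimum of $\mathcal I$ on $W_0^{1,q}(\Omega)$, that is, $\mathcal I(u)\le\mathcal I(v)$ for every $v\in W_0^{1,q}(\Omega)$. Then: (i) if $r=\frac np$, there exists $\lambda>0$ such that $e^{\lambda|u|^{1-\alpha p'}}\in L^1(\Omega)$; (ii) if $r>\frac np$, there exists $L>0$ such that $|u|\le 2L$ almost everywhere in $\Omega$. -/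

import Mathlib

open MeasureTheory Set
open scoped ContDiff

noncomputable section

/-- Smooth test functions with compact support in `Ω`, i.e. the elements of `C_c^∞(Ω)`
(extended by zero to the whole space). -/
def IsTestFunction {n : ℕ} (Ω : Set (EuclideanSpace ℝ (Fin n)))
    (φ : EuclideanSpace ℝ (Fin n) → ℝ) : Prop :=
  ContDiff ℝ ∞ φ ∧ HasCompactSupport φ ∧ tsupport φ ⊆ Ω

/-- `g` is a weak (distributional) gradient of `u` on `Ω`: both are locally integrable on `Ω` and
`∫_Ω u ∇φ = - ∫_Ω φ g` (an identity between vectors) for every test function `φ`. -/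
def IsWeakGradient {n : ℕ} (Ω : Set (EuclideanSpace ℝ (Fin n)))
    (u : EuclideanSpace ℝ (Fin n) → ℝ)
    (g : EuclideanSpace ℝ (Fin n) → EuclideanSpace ℝ (Fin n)) : Prop :=
  LocallyIntegrableOn u Ω volume ∧ LocallyIntegrableOn g Ω volume ∧
    ∀ φ : EuclideanSpace ℝ (Fin n) → ℝ, IsTestFunction Ω φ →
      ∫ x in Ω, u x • gradient φ x = - ∫ x in Ω, φ x • g x

/-- On an open set the weak gradient is unique up to a null set. -/
theorem IsWeakGradient.ae_eq {n : ℕ} {Ω : Set (EuclideanSpace ℝ (Fin n))} (hΩ : IsOpen Ω)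
    {u : EuclideanSpace ℝ (Fin n) → ℝ}
    {g₁ g₂ : EuclideanSpace ℝ (Fin n) → EuclideanSpace ℝ (Fin n)}
    (h₁ : IsWeakGradient Ω u g₁) (h₂ : IsWeakGradient Ω u g₂) :
    g₁ =ᵐ[volume.restrict Ω] g₂ := by
  have key : ∀ᵐ x, x ∈ Ω → g₁ x - g₂ x = 0 := by
    refine hΩ.ae_eq_zero_of_integral_contDiff_smul_eq_zero (h₁.2.1.sub h₂.2.1) ?_
    intro φ hφ hc hs
    have hint : ∀ g : EuclideanSpace ℝ (Fin n) → EuclideanSpace ℝ (Fin n),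
        LocallyIntegrableOn g Ω volume → Integrable (fun x => φ x • g x) volume := by
      intro g hg
      have hk : IntegrableOn g (tsupport φ) volume :=
        hg.integrableOn_compact_subset hs hc
      have : IntegrableOn (fun x => φ x • g x) (tsupport φ) volume :=
        hk.continuousOn_smul hφ.continuous.continuousOn hc
      refine (integrableOn_iff_integrable_of_support_subset ?_).1 this
      intro x hx
      refine subset_tsupport φ ?_
      intro h0
      exact hx (by simp [h0])
    have hfull : ∀ g : EuclideanSpace ℝ (Fin n) → EuclideanSpace ℝ (Fin n),
        ∫ x in Ω, φ x • g x = ∫ x, φ x • g x := by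
      intro g
      refine setIntegral_eq_integral_of_forall_compl_eq_zero ?_
      intro x hx
      have : φ x = 0 := by
        by_contra h0
        exact hx (hs (subset_tsupport φ h0))
      simp [this]
    have e := (h₁.2.2 φ ⟨hφ, hc, hs⟩).symm.trans (h₂.2.2 φ ⟨hφ, hc, hs⟩)
    rw [hfull, hfull, neg_inj] at e
    simp only [smul_sub]
    rw [integral_sub (hint g₁ h₁.2.1) (hint g₂ h₂.2.1), e, sub_self]
  rw [Filter.EventuallyEq, ae_restrict_iff' hΩ.measurableSet]
  filter_upwards [key] with x hx hxΩ
  exact sub_eq_zero.1 (hx hxΩ)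

open Classical in
/-- The weak gradient `∇u` of `u` on `Ω` (a representative of it; `0` if there is none). -/
def weakGradient {n : ℕ} (Ω : Set (EuclideanSpace ℝ (Fin n)))
    (u : EuclideanSpace ℝ (Fin n) → ℝ) : EuclideanSpace ℝ (Fin n) → EuclideanSpace ℝ (Fin n) :=
  if h : ∃ g, IsWeakGradient Ω u g then h.choose else 0

/-- `u` belongs to the Sobolev space `W^{1,q}(Ω)`. -/
def MemSobolev {n : ℕ} (Ω : Set (EuclideanSpace ℝ (Fin n))) (q : ℝ)
    (u : EuclideanSpace ℝ (Fin n) → ℝ) : Prop :=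
  MemLp u (ENNReal.ofReal q) (volume.restrict Ω) ∧
    ∃ g, IsWeakGradient Ω u g ∧ MemLp g (ENNReal.ofReal q) (volume.restrict Ω)

/-- `u` belongs to `W₀^{1,q}(Ω)`, the closure of `C_c^∞(Ω)` in `W^{1,q}(Ω)`. -/
def MemSobolevZero {n : ℕ} (Ω : Set (EuclideanSpace ℝ (Fin n))) (q : ℝ)
    (u : EuclideanSpace ℝ (Fin n) → ℝ) : Prop :=
  MemSobolev Ω q u ∧
    ∀ ε : ℝ, 0 < ε → ∃ φ : EuclideanSpace ℝ (Fin n) → ℝ, IsTestFunction Ω φ ∧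
      eLpNorm (fun x => u x - φ x) (ENNReal.ofReal q) (volume.restrict Ω) < ENNReal.ofReal ε ∧
      eLpNorm (fun x => weakGradient Ω u x - gradient φ x) (ENNReal.ofReal q)
        (volume.restrict Ω) < ENNReal.ofReal ε

/-- `f` belongs to the Marcinkiewicz space `M^r(Ω)`. -/
def MemMarcinkiewicz {n : ℕ} (Ω : Set (EuclideanSpace ℝ (Fin n))) (r : ℝ)
    (f : EuclideanSpace ℝ (Fin n) → ℝ) : Prop :=
  AEMeasurable f (volume.restrict Ω) ∧
    ∃ c : ℝ, 0 < c ∧ ∀ t : ℝ, 0 < t →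
      volume {x ∈ Ω | t < |f x|} ≤ ENNReal.ofReal (c / t ^ r)

open Classical in
/-- The extended functional `𝓘`: it equals
`𝓙(v) = ∫_Ω a(x,v) j(∇v) dx - ∫_Ω f v dx` where this is finite and `+∞` elsewhere. -/
def extendedFunctional {n : ℕ} (Ω : Set (EuclideanSpace ℝ (Fin n)))
    (a : EuclideanSpace ℝ (Fin n) → ℝ → ℝ) (j : EuclideanSpace ℝ (Fin n) → ℝ)
    (f : EuclideanSpace ℝ (Fin n) → ℝ) (v : EuclideanSpace ℝ (Fin n) → ℝ) : EReal :=
  if Integrable (fun x => a x (v x) * j (weakGradient Ω v x)) (volume.restrict Ω) ∧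
      Integrable (fun x => f x * v x) (volume.restrict Ω) then
    (((∫ x in Ω, a x (v x) * j (weakGradient Ω v x)) - ∫ x in Ω, f x * v x : ℝ) : EReal)
  else ⊤

/-- `u` is a minimum of the functional `𝓘` on `W₀^{1,q}(Ω)`. -/
def IsSobolevMinimum {n : ℕ} (Ω : Set (EuclideanSpace ℝ (Fin n))) (q : ℝ)
    (F : (EuclideanSpace ℝ (Fin n) → ℝ) → EReal) (u : EuclideanSpace ℝ (Fin n) → ℝ) : Prop :=
  MemSobolevZero Ω q u ∧ ∀ v, MemSobolevZero Ω q v → F u ≤ F v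

end

open Filter Topology
open scoped ENNReal NNReal

/-! Write U = |u|, G = |∇u|, F = |f|. The truncation T_k u is an admissible competitor, and since
j(0) = 0 its energy is the energy of u on {U < k}. Minimality and the coercivity of j therefore give
(`IsSobolevMinimum.setIntegral_le`) ∫_{U ≥ k} G^p / (B + U)^{αp} ≤ C ∫_{U ≥ k} F (U - k). The
Sobolev inequality for T_h u - T_k u, whose gradient lives on the strip {k ≤ U < h}, gives
(`exists_levelSet_const`) (h - k) |{U ≥ h}|^{1-1/n} ≤ C ∫_{k ≤ U < h} G, and the Marcinkiewicz
condition gives ∫_A F ≤ C |A|^{1-1/r}. From these three estimates on, the argument is measure theory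
for U, F, G.

Critical case (`exists_geometric_decay`). Take the levels k_m = Λ(m+1)^σ with σ = 1/(1-αp'), and put
ν_m = |{U ≥ k_m}|, e_m = the weighted energy of the strip between k_m and k_{m+1}, x_m = (k_{m+1} -
k_m) ν_m^{1-p/n}. Weighted Hölder on the strip and an absorption argument give x_{m+1} ≤ x_m/4 + c
e_m. The power σ is the one for which the weight (B + k_{m+1})^{αp} is compensated by the gap to the
power 1-p, uniformly in m; what remains is a negative power of Λ, so c is as small as desired.
Conversely, the minimality estimate and a layer-cake sum bound the tails of e by a multiple of the
tails of x. Hence the tails of x halve at each step and ν_m decays geometrically. Since U^{1-αp'} is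
comparable to m at level k_m, this is exponential integrability.

Supercritical case (`exists_ae_le_of_level_estimates`). As Ω has finite measure, f also lies in
M^{n/p}, so the critical result applies and U has tails of every polynomial order. Then FU lies in
M^s for some s > n/p, and Hölder on {U ≥ k} gives (h - k) ν(h)^{1-1/n} ≤ K ν(k)^b with b > 1-1/n.
Stampacchia's lemma concludes. -/

/-- `(v, g)` is a limit in `L^s(Ω)` of pairs `(φ, ∇φ)` with `φ` a test function in `Ω`. -/
def IsTestLimit {n : ℕ} (Ω : Set (EuclideanSpace ℝ (Fin n))) (s : ℝ≥0∞)
    (v : EuclideanSpace ℝ (Fin n) → ℝ)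
    (g : EuclideanSpace ℝ (Fin n) → EuclideanSpace ℝ (Fin n)) : Prop :=
  MemLp v s (volume.restrict Ω) ∧ MemLp g s (volume.restrict Ω) ∧
    ∀ ε : ℝ≥0∞, 0 < ε → ∃ φ : EuclideanSpace ℝ (Fin n) → ℝ, IsTestFunction Ω φ ∧
      eLpNorm (v - φ) s (volume.restrict Ω) < ε ∧
      eLpNorm (g - gradient φ) s (volume.restrict Ω) < ε

/-! ### Test functions and their gradients. -/

section TestFunction

variable {n : ℕ} {Ω : Set (EuclideanSpace ℝ (Fin n))} {φ ψ : EuclideanSpace ℝ (Fin n) → ℝ}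

theorem gradient_eq_toDual_symm_fderiv (φ : EuclideanSpace ℝ (Fin n) → ℝ) :
    gradient φ =
      fun x => (InnerProductSpace.toDual ℝ (EuclideanSpace ℝ (Fin n))).symm (fderiv ℝ φ x) := rfl

theorem enorm_gradient (φ : EuclideanSpace ℝ (Fin n) → ℝ) (x : EuclideanSpace ℝ (Fin n)) :
    ‖gradient φ x‖ₑ = ‖fderiv ℝ φ x‖ₑ := by
  rw [← ofReal_norm, ← ofReal_norm]
  congr 1
  exact LinearIsometryEquiv.norm_map _ _

theorem IsTestFunction.continuous_gradient (hφ : IsTestFunction Ω φ) :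
    Continuous (gradient φ) := by
  rw [gradient_eq_toDual_symm_fderiv]
  exact (LinearIsometryEquiv.continuous _).comp (hφ.1.continuous_fderiv (by simp))

theorem IsTestFunction.hasCompactSupport_gradient (hφ : IsTestFunction Ω φ) :
    HasCompactSupport (gradient φ) := by
  rw [gradient_eq_toDual_symm_fderiv]
  exact (hφ.2.1.fderiv (𝕜 := ℝ)).comp_left (map_zero _)

theorem IsTestFunction.eq_zero_of_notMem (hφ : IsTestFunction Ω φ) {x : EuclideanSpace ℝ (Fin n)}
    (hx : x ∉ Ω) : φ x = 0 :=
  image_eq_zero_of_notMem_tsupport fun h => hx (hφ.2.2 h)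

theorem IsTestFunction.fderiv_eq_zero_of_notMem (hφ : IsTestFunction Ω φ)
    {x : EuclideanSpace ℝ (Fin n)} (hx : x ∉ Ω) : fderiv ℝ φ x = 0 :=
  image_eq_zero_of_notMem_tsupport fun h => hx (hφ.2.2 (tsupport_fderiv_subset ℝ h))

theorem IsTestFunction.gradient_eq_zero_of_notMem (hφ : IsTestFunction Ω φ)
    {x : EuclideanSpace ℝ (Fin n)} (hx : x ∉ Ω) : gradient φ x = 0 := by
  simp [gradient_eq_toDual_symm_fderiv, hφ.fderiv_eq_zero_of_notMem hx]

theorem IsTestFunction.memLp (hφ : IsTestFunction Ω φ) (s : ℝ≥0∞) :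
    MemLp φ s (volume.restrict Ω) :=
  (hφ.1.continuous.memLp_of_hasCompactSupport hφ.2.1).restrict Ω

theorem IsTestFunction.memLp_gradient (hφ : IsTestFunction Ω φ) (s : ℝ≥0∞) :
    MemLp (gradient φ) s (volume.restrict Ω) :=
  (hφ.continuous_gradient.memLp_of_hasCompactSupport hφ.hasCompactSupport_gradient).restrict Ω

theorem IsTestFunction.sub (hφ : IsTestFunction Ω φ) (hψ : IsTestFunction Ω ψ) :
    IsTestFunction Ω (φ - ψ) :=
  ⟨hφ.1.sub hψ.1, hφ.2.1.sub hψ.2.1,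
    (tsupport_sub φ ψ).trans (union_subset hφ.2.2 hψ.2.2)⟩

theorem IsTestFunction.gradient_sub (hφ : IsTestFunction Ω φ) (hψ : IsTestFunction Ω ψ) :
    gradient (φ - ψ) = gradient φ - gradient ψ := by
  ext1 x
  simp only [gradient_eq_toDual_symm_fderiv, Pi.sub_apply]
  rw [fderiv_sub (hφ.1.differentiable (by simp) x) (hψ.1.differentiable (by simp) x), map_sub]

theorem isTestFunction_zero : IsTestFunction Ω 0 := by
  refine ⟨contDiff_const, HasCompactSupport.zero, ?_⟩
  simp

theorem IsTestFunction.comp (hφ : IsTestFunction Ω φ) {F : ℝ → ℝ} (hF : ContDiff ℝ ∞ F)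
    (hF0 : F 0 = 0) : IsTestFunction Ω (F ∘ φ) :=
  ⟨hF.comp hφ.1, hφ.2.1.comp_left hF0, (tsupport_comp_subset hF0 φ).trans hφ.2.2⟩

theorem IsTestFunction.gradient_comp (hφ : IsTestFunction Ω φ) {F : ℝ → ℝ} (hF : ContDiff ℝ ∞ F) :
    gradient (F ∘ φ) = fun x => deriv F (φ x) • gradient φ x := by
  ext1 x
  simp only [gradient_eq_toDual_symm_fderiv]
  have h := (hF.differentiable (by simp) (φ x)).hasDerivAt.comp_hasFDerivAt x
    (hφ.1.differentiable (by simp) x).hasFDerivAt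
  rw [h.fderiv, map_smul]

/-- Integration by parts for two test functions. -/
theorem IsTestFunction.integral_smul_gradient (hφ : IsTestFunction Ω φ)
    (hψ : IsTestFunction Ω ψ) :
    ∫ x in Ω, φ x • gradient ψ x = - ∫ x in Ω, ψ x • gradient φ x := by
  have hint : ∀ {φ ψ : EuclideanSpace ℝ (Fin n) → ℝ}, IsTestFunction Ω φ → IsTestFunction Ω ψ →
      Integrable (fun x => φ x • gradient ψ x) := fun hφ hψ =>
    (hφ.1.continuous.smul hψ.continuous_gradient).integrable_of_hasCompactSupport
      (hφ.2.1.smul_right)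
  rw [setIntegral_eq_integral_of_forall_compl_eq_zero
      (fun x hx => by simp [hφ.eq_zero_of_notMem hx]),
    setIntegral_eq_integral_of_forall_compl_eq_zero
      (fun x hx => by simp [hψ.eq_zero_of_notMem hx])]
  -- Pairing with a fixed vector reduces the vector identity to scalar integration by parts for the
  -- derivative in the direction w.
  refine ext_inner_right ℝ fun w => ?_
  rw [inner_neg_left, real_inner_comm, real_inner_comm w, ← integral_inner (hint hφ hψ),
    ← integral_inner (hint hψ hφ)]
  have e : ∀ (φ ψ : EuclideanSpace ℝ (Fin n) → ℝ) (x : EuclideanSpace ℝ (Fin n)),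
      inner ℝ w (φ x • gradient ψ x) = φ x * fderiv ℝ ψ x w := fun φ ψ x => by
    rw [inner_smul_right, inner_gradient_right]; rfl
  have i₁ := (hint hφ hψ).const_inner (𝕜 := ℝ) w
  have i₂ := (hint hψ hφ).const_inner (𝕜 := ℝ) w
  simp only [e] at i₁ i₂ ⊢
  rw [integral_mul_fderiv_eq_neg_fderiv_mul_of_integrable _ i₁ _
    (fun x _ => hφ.1.differentiable (by simp) x) (fun x _ => hψ.1.differentiable (by simp) x)]
  · simp only [mul_comm]
  · simpa only [mul_comm] using i₂
  · exact (hφ.1.continuous.mul hψ.1.continuous).integrable_of_hasCompactSupport hφ.2.1.mul_right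

end TestFunction

/-! ### Convergence in L^s and the closure of the test functions. -/

/-- If `fᵢ → f` in `L^s`, `s ≥ 1`, on a set of finite measure, then `fᵢ → f` in `L^1`. -/
theorem tendsto_eLpNorm_one_of_tendsto_eLpNorm {α E : Type*} [MeasurableSpace α] {μ : Measure α}
    [IsFiniteMeasure μ] [NormedAddCommGroup E] {s : ℝ≥0∞} (hs : 1 ≤ s)
    {f : α → E} {fs : ℕ → α → E} (hf : MemLp f s μ) (hfs : ∀ i, MemLp (fs i) s μ)
    (h : Tendsto (fun i => eLpNorm (fs i - f) s μ) atTop (𝓝 0)) :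
    Tendsto (fun i => eLpNorm (fs i - f) 1 μ) atTop (𝓝 0) := by
  have hb : ∀ i, eLpNorm (fs i - f) 1 μ ≤
      eLpNorm (fs i - f) s μ * μ univ ^ (1 / (1 : ℝ≥0∞).toReal - 1 / s.toReal) := fun i =>
    eLpNorm_le_eLpNorm_mul_rpow_measure_univ hs ((hfs i).sub hf).1
  refine tendsto_of_tendsto_of_tendsto_of_le_of_le tendsto_const_nhds ?_ (fun _ => zero_le) hb
  have : Tendsto (fun i => eLpNorm (fs i - f) s μ *
      μ univ ^ (1 / (1 : ℝ≥0∞).toReal - 1 / s.toReal)) atTop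
      (𝓝 (0 * μ univ ^ (1 / (1 : ℝ≥0∞).toReal - 1 / s.toReal))) := by
    refine ENNReal.Tendsto.mul_const h (Or.inr ?_)
    rcases eq_or_ne s ⊤ with rfl | hs'
    · simp [measure_ne_top]
    · refine ENNReal.rpow_ne_top_of_nonneg ?_ (measure_ne_top _ _)
      have : 1 ≤ s.toReal := by
        rw [← ENNReal.toReal_one]; exact ENNReal.toReal_mono hs' hs
      simp only [ENNReal.toReal_one, sub_nonneg]
      exact one_div_le_one_div_of_le one_pos this
  simpa using this

/-- Bounded multipliers are continuous on `L^s`. -/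
theorem tendsto_eLpNorm_of_norm_le_mul {α E F : Type*} [MeasurableSpace α] {μ : Measure α}
    [NormedAddCommGroup E] [NormedAddCommGroup F] {s : ℝ≥0∞} {f : ℕ → α → E} {g : ℕ → α → F}
    {K : ℝ} (hfg : ∀ i x, ‖f i x‖ ≤ K * ‖g i x‖)
    (h : Tendsto (fun i => eLpNorm (g i) s μ) atTop (𝓝 0)) :
    Tendsto (fun i => eLpNorm (f i) s μ) atTop (𝓝 0) := by
  have hK : Tendsto (fun i => ENNReal.ofReal K * eLpNorm (g i) s μ) atTop (𝓝 0) := by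
    simpa using ENNReal.Tendsto.const_mul (a := ENNReal.ofReal K) h (Or.inr ENNReal.ofReal_ne_top)
  exact tendsto_of_tendsto_of_tendsto_of_le_of_le tendsto_const_nhds hK (fun _ => zero_le)
    fun i => eLpNorm_le_mul_eLpNorm_of_ae_le_mul (Eventually.of_forall (hfg i)) s

section TestLimit

variable {n : ℕ} {Ω : Set (EuclideanSpace ℝ (Fin n))} {s : ℝ≥0∞}
  {v w : EuclideanSpace ℝ (Fin n) → ℝ}
  {g h : EuclideanSpace ℝ (Fin n) → EuclideanSpace ℝ (Fin n)}

theorem IsTestFunction.isTestLimit {φ : EuclideanSpace ℝ (Fin n) → ℝ} (hφ : IsTestFunction Ω φ) :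
    IsTestLimit Ω s φ (gradient φ) :=
  ⟨hφ.memLp s, hφ.memLp_gradient s, fun ε hε => ⟨φ, hφ, by simpa, by simpa⟩⟩

theorem IsTestLimit.exists_seq (hv : IsTestLimit Ω s v g) :
    ∃ φ : ℕ → EuclideanSpace ℝ (Fin n) → ℝ, (∀ i, IsTestFunction Ω (φ i)) ∧
      Tendsto (fun i => eLpNorm (φ i - v) s (volume.restrict Ω)) atTop (𝓝 0) ∧
      Tendsto (fun i => eLpNorm (gradient (φ i) - g) s (volume.restrict Ω)) atTop (𝓝 0) := by
  obtain ⟨a, -, ha0, ha⟩ := exists_seq_strictAnti_tendsto' ENNReal.zero_lt_top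
  choose φ hφ h₁ h₂ using fun i => hv.2.2 (a i) (ha0 i).1
  refine ⟨φ, hφ, ?_, ?_⟩
  · refine tendsto_of_tendsto_of_tendsto_of_le_of_le tendsto_const_nhds ha (fun _ => zero_le)
      fun i => ?_
    rw [eLpNorm_sub_comm]
    exact (h₁ i).le
  · refine tendsto_of_tendsto_of_tendsto_of_le_of_le tendsto_const_nhds ha (fun _ => zero_le)
      fun i => ?_
    rw [eLpNorm_sub_comm]
    exact (h₂ i).le

theorem isTestLimit_of_tendsto (hs : 1 ≤ s) (hv : MemLp v s (volume.restrict Ω))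
    (hg : MemLp g s (volume.restrict Ω)) {vs : ℕ → EuclideanSpace ℝ (Fin n) → ℝ}
    {gs : ℕ → EuclideanSpace ℝ (Fin n) → EuclideanSpace ℝ (Fin n)}
    (h : ∀ i, IsTestLimit Ω s (vs i) (gs i))
    (h₁ : Tendsto (fun i => eLpNorm (vs i - v) s (volume.restrict Ω)) atTop (𝓝 0))
    (h₂ : Tendsto (fun i => eLpNorm (gs i - g) s (volume.restrict Ω)) atTop (𝓝 0)) :
    IsTestLimit Ω s v g := by
  refine ⟨hv, hg, fun ε hε => ?_⟩
  have hε2 : 0 < ε / 2 := ENNReal.half_pos hε.ne'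
  obtain ⟨i, hi₁, hi₂⟩ :=
    ((h₁.eventually (gt_mem_nhds hε2)).and (h₂.eventually (gt_mem_nhds hε2))).exists
  obtain ⟨φ, hφ, hφ₁, hφ₂⟩ := (h i).2.2 (ε / 2) hε2
  refine ⟨φ, hφ, ?_, ?_⟩
  · have e : v - φ = (v - vs i) + (vs i - φ) := by abel
    rw [e]
    refine (eLpNorm_add_le (hv.sub (h i).1).1 ((h i).1.sub (hφ.memLp s)).1 hs).trans_lt ?_
    rw [eLpNorm_sub_comm, ← ENNReal.add_halves ε]
    exact ENNReal.add_lt_add hi₁ hφ₁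
  · have e : g - gradient φ = (g - gs i) + (gs i - gradient φ) := by abel
    rw [e]
    refine (eLpNorm_add_le (hg.sub (h i).2.1).1
      ((h i).2.1.sub (hφ.memLp_gradient s)).1 hs).trans_lt ?_
    rw [eLpNorm_sub_comm, ← ENNReal.add_halves ε]
    exact ENNReal.add_lt_add hi₂ hφ₂

theorem IsTestLimit.sub (hs : 1 ≤ s) (hv : IsTestLimit Ω s v g) (hw : IsTestLimit Ω s w h) :
    IsTestLimit Ω s (v - w) (g - h) := by
  refine ⟨hv.1.sub hw.1, hv.2.1.sub hw.2.1, fun ε hε => ?_⟩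
  have hε2 : 0 < ε / 2 := ENNReal.half_pos hε.ne'
  obtain ⟨φ, hφ, hφ₁, hφ₂⟩ := hv.2.2 (ε / 2) hε2
  obtain ⟨ψ, hψ, hψ₁, hψ₂⟩ := hw.2.2 (ε / 2) hε2
  refine ⟨φ - ψ, hφ.sub hψ, ?_, ?_⟩
  · have e : v - w - (φ - ψ) = (v - φ) - (w - ψ) := by abel
    rw [e]
    refine (eLpNorm_sub_le (hv.1.sub (hφ.memLp s)).1 (hw.1.sub (hψ.memLp s)).1 hs).trans_lt ?_
    rw [← ENNReal.add_halves ε]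
    exact ENNReal.add_lt_add hφ₁ hψ₁
  · have e : g - h - gradient (φ - ψ) = (g - gradient φ) - (h - gradient ψ) := by
      rw [hφ.gradient_sub hψ]; abel
    rw [e]
    refine (eLpNorm_sub_le (hv.2.1.sub (hφ.memLp_gradient s)).1
      (hw.2.1.sub (hψ.memLp_gradient s)).1 hs).trans_lt ?_
    rw [← ENNReal.add_halves ε]
    exact ENNReal.add_lt_add hφ₂ hψ₂

theorem IsTestLimit.congr_ae (hv : IsTestLimit Ω s v g) (h₁ : v =ᵐ[volume.restrict Ω] w)
    (h₂ : g =ᵐ[volume.restrict Ω] h) : IsTestLimit Ω s w h := by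
  refine ⟨hv.1.ae_eq h₁, hv.2.1.ae_eq h₂, fun ε hε => ?_⟩
  obtain ⟨φ, hφ, hφ₁, hφ₂⟩ := hv.2.2 ε hε
  refine ⟨φ, hφ, ?_, ?_⟩
  · rwa [← eLpNorm_congr_ae (h₁.sub (ae_eq_refl φ))]
  · rwa [← eLpNorm_congr_ae (h₂.sub (ae_eq_refl (gradient φ)))]


/-- Integration by parts holds for the approximating test functions and passes to the limit: on
finite measure L^s convergence implies L^1 convergence, and ψ and its gradient are bounded
multipliers. -/
theorem IsTestLimit.isWeakGradient [IsFiniteMeasure (volume.restrict Ω)] (hs : 1 ≤ s)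
    (hv : IsTestLimit Ω s v g) : IsWeakGradient Ω v g := by
  refine ⟨IntegrableOn.locallyIntegrableOn (hv.1.integrable hs),
    IntegrableOn.locallyIntegrableOn (hv.2.1.integrable hs), fun ψ hψ => ?_⟩
  obtain ⟨φ, hφ, h₁, h₂⟩ := hv.exists_seq
  replace h₁ := tendsto_eLpNorm_one_of_tendsto_eLpNorm hs hv.1 (fun i => (hφ i).memLp s) h₁
  replace h₂ :=
    tendsto_eLpNorm_one_of_tendsto_eLpNorm hs hv.2.1 (fun i => (hφ i).memLp_gradient s) h₂
  obtain ⟨K₁, hK₁⟩ := hψ.hasCompactSupport_gradient.exists_bound_of_continuous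
    hψ.continuous_gradient
  obtain ⟨K₂, hK₂⟩ := hψ.2.1.exists_bound_of_continuous hψ.1.continuous
  have lim₁ : Tendsto (fun i => ∫ x in Ω, φ i x • gradient ψ x) atTop
      (𝓝 (∫ x in Ω, v x • gradient ψ x)) := by
    refine tendsto_integral_of_L1' _ ?_ (Eventually.of_forall fun i => ?_) ?_
    · exact hv.1.1.smul hψ.continuous_gradient.aestronglyMeasurable
    · exact (((hφ i).memLp s).integrable hs).smul_bdd K₁
        hψ.continuous_gradient.aestronglyMeasurable (Eventually.of_forall hK₁)
    · refine tendsto_eLpNorm_of_norm_le_mul (K := K₁) (fun i x => ?_) h₁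
      simp only [Pi.sub_apply, ← sub_smul, norm_smul]
      rw [mul_comm]
      gcongr
      exact hK₁ x
  have lim₂ : Tendsto (fun i => ∫ x in Ω, ψ x • gradient (φ i) x) atTop
      (𝓝 (∫ x in Ω, ψ x • g x)) := by
    refine tendsto_integral_of_L1' _ ?_ (Eventually.of_forall fun i => ?_) ?_
    · exact hψ.1.continuous.aestronglyMeasurable.smul hv.2.1.1
    · exact (((hφ i).memLp_gradient s).integrable hs).bdd_smul K₂
        hψ.1.continuous.aestronglyMeasurable (Eventually.of_forall hK₂)
    · refine tendsto_eLpNorm_of_norm_le_mul (K := K₂) (fun i x => ?_) h₂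
      simp only [Pi.sub_apply, ← smul_sub, norm_smul]
      gcongr
      exact hK₂ x
  refine tendsto_nhds_unique lim₁ ?_
  simp only [(hφ _).integral_smul_gradient hψ]
  exact lim₂.neg

theorem IsWeakGradient.weakGradient_ae_eq (hΩ : IsOpen Ω) (hg : IsWeakGradient Ω v g) :
    weakGradient Ω v =ᵐ[volume.restrict Ω] g := by
  have hex : ∃ g, IsWeakGradient Ω v g := ⟨g, hg⟩
  rw [weakGradient, dif_pos hex]
  exact hex.choose_spec.ae_eq hΩ hg

theorem IsTestLimit.weakGradient_ae_eq [IsFiniteMeasure (volume.restrict Ω)] (hΩ : IsOpen Ω)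
    (hs : 1 ≤ s) (hv : IsTestLimit Ω s v g) : weakGradient Ω v =ᵐ[volume.restrict Ω] g :=
  (hv.isWeakGradient hs).weakGradient_ae_eq hΩ

/-- This and its converse `MemSobolevZero.isTestLimit` allow the Sobolev arguments to be run on
explicit pairs (v, g), without reference to the chosen representative `weakGradient`. -/
theorem IsTestLimit.memSobolevZero [IsFiniteMeasure (volume.restrict Ω)] (hΩ : IsOpen Ω)
    {q : ℝ} (hq : 1 ≤ q) (hv : IsTestLimit Ω (ENNReal.ofReal q) v g) : MemSobolevZero Ω q v := by
  have hq' : 1 ≤ ENNReal.ofReal q := ENNReal.one_le_ofReal.2 hq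
  refine ⟨⟨hv.1, g, hv.isWeakGradient hq', hv.2.1⟩, fun ε hε => ?_⟩
  exact (hv.congr_ae (ae_eq_refl v) (hv.weakGradient_ae_eq hΩ hq').symm).2.2 _
    (ENNReal.ofReal_pos.2 hε)

theorem MemSobolevZero.isTestLimit (hΩ : IsOpen Ω) {q : ℝ} (hv : MemSobolevZero Ω q v) :
    IsTestLimit Ω (ENNReal.ofReal q) v (weakGradient Ω v) := by
  obtain ⟨⟨h₁, g, hg, h₂⟩, h₃⟩ := hv
  refine ⟨h₁, h₂.ae_eq (hg.weakGradient_ae_eq hΩ).symm, fun ε hε => ?_⟩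
  -- Here ε may be infinite while the radius in `MemSobolevZero` is real; the minimum with 1 makes
  -- it finite.
  obtain ⟨φ, hφ, hφ₁, hφ₂⟩ := h₃ (min ε 1).toReal
    (ENNReal.toReal_pos (lt_min hε one_pos).ne' (by simp))
  rw [ENNReal.ofReal_toReal (by simp)] at hφ₁ hφ₂
  exact ⟨φ, hφ, hφ₁.trans_le (min_le_left _ _), hφ₂.trans_le (min_le_left _ _)⟩

end TestLimit

/-! ### The chain rule. -/

/-- Dominated convergence in `L^s`. -/
theorem tendsto_eLpNorm_zero_of_dominated {α E F : Type*} [MeasurableSpace α] {μ : Measure α}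
    [NormedAddCommGroup E] [NormedAddCommGroup F] {s : ℝ≥0∞} (hs0 : s ≠ 0) (hs : s ≠ ⊤)
    {f : ℕ → α → E} {h : α → F} (hf : ∀ i, AEStronglyMeasurable (f i) μ) (hh : MemLp h s μ)
    (hfh : ∀ i, ∀ᵐ x ∂μ, ‖f i x‖ ≤ ‖h x‖)
    (hlim : ∀ᵐ x ∂μ, Tendsto (fun i => f i x) atTop (𝓝 0)) :
    Tendsto (fun i => eLpNorm (f i) s μ) atTop (𝓝 0) := by
  have hs1 : 0 < s.toReal := ENNReal.toReal_pos hs0 hs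
  have key : Tendsto (fun i => ∫⁻ x, ‖f i x‖ₑ ^ s.toReal ∂μ) atTop (𝓝 (∫⁻ _, 0 ∂μ)) := by
    refine tendsto_lintegral_of_dominated_convergence' (fun x => ‖h x‖ₑ ^ s.toReal)
      (fun i => (hf i).enorm.pow_const _) (fun i => ?_) ?_ ?_
    · filter_upwards [hfh i] with x hx
      exact ENNReal.rpow_le_rpow (enorm_le_iff_norm_le.2 hx) hs1.le
    · exact (lintegral_rpow_enorm_lt_top_of_eLpNorm_lt_top hs0 hs hh.2).ne
    · filter_upwards [hlim] with x hx
      have := (ENNReal.continuous_rpow_const (y := s.toReal)).tendsto _ |>.comp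
        ((continuous_enorm.tendsto _).comp hx)
      simpa [Function.comp_def, ENNReal.zero_rpow_of_pos hs1] using this
  simp only [lintegral_zero] at key
  have := (ENNReal.continuous_rpow_const (y := 1 / s.toReal)).tendsto _ |>.comp key
  rw [ENNReal.zero_rpow_of_pos (by positivity)] at this
  simpa only [eLpNorm_eq_lintegral_rpow_enorm_toReal hs0 hs, Function.comp_def] using this

/-- A differentiable real function with derivative bounded by `K` is `K`-Lipschitz. -/
theorem abs_sub_le_of_abs_deriv_le {F : ℝ → ℝ} (hF : Differentiable ℝ F) {K : ℝ}
    (hK : ∀ t, |deriv F t| ≤ K) (a b : ℝ) : |F a - F b| ≤ K * |a - b| :=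
  convex_univ.norm_image_sub_le_of_norm_deriv_le (fun t _ => hF t) (fun t _ => hK t)
    (mem_univ b) (mem_univ a)

section ChainRule

variable {n : ℕ} {Ω : Set (EuclideanSpace ℝ (Fin n))} {s : ℝ≥0∞}
  {v : EuclideanSpace ℝ (Fin n) → ℝ} {g : EuclideanSpace ℝ (Fin n) → EuclideanSpace ℝ (Fin n)}

theorem IsTestLimit.exists_seq_ae (hs : 1 ≤ s) (hv : IsTestLimit Ω s v g) :
    ∃ φ : ℕ → EuclideanSpace ℝ (Fin n) → ℝ, (∀ i, IsTestFunction Ω (φ i)) ∧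
      Tendsto (fun i => eLpNorm (φ i - v) s (volume.restrict Ω)) atTop (𝓝 0) ∧
      Tendsto (fun i => eLpNorm (gradient (φ i) - g) s (volume.restrict Ω)) atTop (𝓝 0) ∧
      ∀ᵐ x ∂volume.restrict Ω, Tendsto (fun i => φ i x) atTop (𝓝 (v x)) := by
  obtain ⟨φ, hφ, h₁, h₂⟩ := hv.exists_seq
  obtain ⟨k, hk, hae⟩ := (tendstoInMeasure_of_tendsto_eLpNorm (one_pos.trans_le hs).ne'
    (fun i => ((hφ i).memLp s).1) hv.1.1 h₁).exists_seq_tendsto_ae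
  exact ⟨fun i => φ (k i), fun i => hφ _, h₁.comp hk.tendsto_atTop, h₂.comp hk.tendsto_atTop, hae⟩

/-- Chain rule for smooth functions with bounded derivative. -/
theorem IsTestLimit.comp (hs : 1 ≤ s) (hs' : s ≠ ⊤) (hv : IsTestLimit Ω s v g) {F : ℝ → ℝ}
    (hF : ContDiff ℝ ∞ F) (hF0 : F 0 = 0) {K : ℝ} (hK : ∀ t, |deriv F t| ≤ K) :
    IsTestLimit Ω s (F ∘ v) (fun x => deriv F (v x) • g x) := by
  have hs0 : s ≠ 0 := (one_pos.trans_le hs).ne'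
  have hFd : Differentiable ℝ F := hF.differentiable (by simp)
  have hF' : Continuous (deriv F) := hF.continuous_deriv (by simp)
  have hK0 : 0 ≤ K := (abs_nonneg _).trans (hK 0)
  have hlip := abs_sub_le_of_abs_deriv_le hFd hK
  have hmv : AEStronglyMeasurable (fun x => deriv F (v x)) (volume.restrict Ω) :=
    hF'.comp_aestronglyMeasurable hv.1.1
  obtain ⟨φ, hφ, h₁, h₂, h₃⟩ := hv.exists_seq_ae hs
  refine isTestLimit_of_tendsto (vs := fun i => F ∘ φ i) (gs := fun i => gradient (F ∘ φ i)) hs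
    ?_ ?_ (fun i => ((hφ i).comp hF hF0).isTestLimit) ?_ ?_
  · refine hv.1.of_le_mul (c := K) (hF.continuous.comp_aestronglyMeasurable hv.1.1)
      (Eventually.of_forall fun x => ?_)
    simpa [hF0] using hlip (v x) 0
  · refine hv.2.1.of_le_mul (c := K) (hmv.smul hv.2.1.1) (Eventually.of_forall fun x => ?_)
    rw [norm_smul]
    exact mul_le_mul_of_nonneg_right (hK _) (norm_nonneg _)
  · exact tendsto_eLpNorm_of_norm_le_mul (fun i x => hlip _ _) h₁
  · have lim₁ : Tendsto (fun i => eLpNorm (fun x => deriv F (φ i x) • (gradient (φ i) x - g x)) s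
        (volume.restrict Ω)) atTop (𝓝 0) := by
      refine tendsto_eLpNorm_of_norm_le_mul (K := K) (fun i x => ?_) h₂
      rw [norm_smul]
      exact mul_le_mul_of_nonneg_right (hK _) (norm_nonneg _)
    have hm₂ : ∀ i, AEStronglyMeasurable (fun x => (deriv F (φ i x) - deriv F (v x)) • g x)
        (volume.restrict Ω) := fun i =>
      ((hF'.comp (hφ i).1.continuous).aestronglyMeasurable.sub hmv).smul hv.2.1.1
    have lim₂ : Tendsto (fun i => eLpNorm (fun x => (deriv F (φ i x) - deriv F (v x)) • g x) s
        (volume.restrict Ω)) atTop (𝓝 0) := by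
      refine tendsto_eLpNorm_zero_of_dominated (h := fun x => (2 * K) • g x) hs0 hs' hm₂
        (hv.2.1.const_smul (2 * K)) (fun i => Eventually.of_forall fun x => ?_) ?_
      · rw [norm_smul, norm_smul]
        refine mul_le_mul_of_nonneg_right ?_ (norm_nonneg _)
        rw [Real.norm_of_nonneg (by positivity : 0 ≤ 2 * K), Real.norm_eq_abs]
        have := abs_sub (deriv F (φ i x)) (deriv F (v x))
        linarith [hK (φ i x), hK (v x)]
      · filter_upwards [h₃] with x hx
        have := ((hF'.tendsto _).comp hx).sub_const (deriv F (v x))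
        simpa using this.smul_const (g x)
    have lim := lim₁.add lim₂
    rw [add_zero] at lim
    refine tendsto_of_tendsto_of_tendsto_of_le_of_le tendsto_const_nhds lim (fun _ => zero_le)
      fun i => ?_
    have e : (gradient (F ∘ φ i) - fun x => deriv F (v x) • g x) =
        (fun x => deriv F (φ i x) • (gradient (φ i) x - g x)) +
          fun x => (deriv F (φ i x) - deriv F (v x)) • g x := by
      ext1 x
      simp only [(hφ i).gradient_comp hF, Pi.sub_apply, Pi.add_apply, smul_sub, sub_smul]
      abel
    simp only [e]
    exact eLpNorm_add_le ((hF'.comp (hφ i).1.continuous).aestronglyMeasurable.smul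
      (((hφ i).memLp_gradient s).1.sub hv.2.1.1)) (hm₂ i) hs

end ChainRule

/-! ### Truncations and their gradients. -/

section Truncation

/-- Truncation of a real number at the levels `±k`. -/
def truncation (k t : ℝ) : ℝ := max (-k) (min t k)

theorem continuous_truncation (k : ℝ) : Continuous (truncation k) := by
  unfold truncation; fun_prop

theorem truncation_of_abs_le {k t : ℝ} (h : |t| ≤ k) : truncation k t = t := by
  rw [abs_le] at h
  rw [truncation, min_eq_left h.2, max_eq_right h.1]

theorem abs_truncation_le {k t : ℝ} (hk : 0 ≤ k) : |truncation k t| ≤ |t| := by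
  unfold truncation
  rcases le_total t k with h | h
  · rw [min_eq_left h]
    rcases le_total (-k) t with h' | h'
    · rw [max_eq_right h']
    · rw [max_eq_left h', abs_neg, abs_of_nonneg hk]
      exact le_abs.2 (Or.inr (by linarith))
  · rw [min_eq_right h, max_eq_right (by linarith), abs_of_nonneg hk]
    exact le_abs.2 (Or.inl h)

theorem abs_sub_truncation {k t : ℝ} (hk : 0 ≤ k) (h : k ≤ |t|) :
    |t - truncation k t| = |t| - k := by
  unfold truncation
  rcases le_abs.1 h with h | h
  · rw [min_eq_right h, max_eq_right (by linarith), abs_of_nonneg (by linarith),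
      abs_of_nonneg (by linarith)]
  · rw [min_eq_left (by linarith), max_eq_left (by linarith), abs_of_nonpos (by linarith),
      abs_of_nonpos (by linarith)]
    ring

/-- Smooth cut-off functions increasing to the indicator of `(-k, k)`. -/
noncomputable def smoothCutoff (k : ℝ) (m : ℕ) (t : ℝ) : ℝ :=
  Real.smoothTransition (m * (k - t)) * Real.smoothTransition (m * (k + t))

theorem contDiff_smoothCutoff (k : ℝ) (m : ℕ) : ContDiff ℝ ∞ (smoothCutoff k m) := by
  unfold smoothCutoff
  exact (Real.smoothTransition.contDiff.comp (by fun_prop)).mul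
    (Real.smoothTransition.contDiff.comp (by fun_prop))

theorem smoothCutoff_nonneg (k : ℝ) (m : ℕ) (t : ℝ) : 0 ≤ smoothCutoff k m t :=
  mul_nonneg (Real.smoothTransition.nonneg _) (Real.smoothTransition.nonneg _)

theorem smoothCutoff_le_one (k : ℝ) (m : ℕ) (t : ℝ) : smoothCutoff k m t ≤ 1 :=
  mul_le_one₀ (Real.smoothTransition.le_one _) (Real.smoothTransition.nonneg _)
    (Real.smoothTransition.le_one _)

theorem tendsto_smoothCutoff (k t : ℝ) :
    Tendsto (fun m => smoothCutoff k m t) atTop (𝓝 ((Ioo (-k) k).indicator 1 t)) := by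
  refine tendsto_nhds_of_eventually_eq ?_
  by_cases h : t ∈ Ioo (-k) k
  · rw [indicator_of_mem h]
    have h₁ : 0 < k - t := by linarith [h.2]
    have h₂ : 0 < k + t := by linarith [h.1]
    filter_upwards [(tendsto_natCast_atTop_atTop.atTop_mul_const h₁).eventually_ge_atTop 1,
      (tendsto_natCast_atTop_atTop.atTop_mul_const h₂).eventually_ge_atTop 1] with m hm₁ hm₂
    rw [smoothCutoff, Real.smoothTransition.one_of_one_le hm₁,
      Real.smoothTransition.one_of_one_le hm₂, one_mul, Pi.one_apply]
  · rw [indicator_of_notMem h]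
    refine Eventually.of_forall fun m => ?_
    rw [mem_Ioo, not_and_or, not_lt, not_lt] at h
    -- Outside the open interval, endpoints included, one factor vanishes for every m; this is why
    -- the limit gradient carries the strict condition |v| < k.
    rcases h with h | h
    · rw [smoothCutoff, Real.smoothTransition.zero_of_nonpos (x := m * (k + t)), mul_zero]
      exact mul_nonpos_of_nonneg_of_nonpos (Nat.cast_nonneg m) (by linarith)
    · rw [smoothCutoff, Real.smoothTransition.zero_of_nonpos (x := m * (k - t)), zero_mul]
      exact mul_nonpos_of_nonneg_of_nonpos (Nat.cast_nonneg m) (by linarith)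

/-- T_k is the primitive of the indicator of (-k, k), so primitives of smooth cut-offs converge to
it while their derivatives converge everywhere to that indicator. -/
theorem integral_indicator_Ioo_eq_truncation {k : ℝ} (hk : 0 < k) (t : ℝ) :
    ∫ x in (0 : ℝ)..t, (Ioo (-k) k).indicator (1 : ℝ → ℝ) x = truncation k t := by
  rcases le_total 0 t with ht | ht
  · rw [intervalIntegral.integral_of_le ht, setIntegral_indicator measurableSet_Ioo]
    rcases lt_or_ge t k with h | h
    · have e : Ioc 0 t ∩ Ioo (-k) k = Ioc 0 t := inter_eq_left.2 fun x hx =>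
        ⟨by linarith [hx.1], hx.2.trans_lt h⟩
      rw [e, truncation_of_abs_le (by rw [abs_of_nonneg ht]; exact h.le)]
      simp [ht]
    · have e : Ioc 0 t ∩ Ioo (-k) k = Ioo 0 k := by
        ext x
        exact ⟨fun hx => ⟨hx.1.1, hx.2.2⟩,
          fun hx => ⟨⟨hx.1, hx.2.le.trans h⟩, by linarith [hx.1], hx.2⟩⟩
      rw [e, truncation, min_eq_right h, max_eq_right (by linarith)]
      simp [hk.le]
  · rw [intervalIntegral.integral_of_ge ht, setIntegral_indicator measurableSet_Ioo]
    rcases le_or_gt (-k) t with h | h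
    · have e : Ioc t 0 ∩ Ioo (-k) k = Ioc t 0 := inter_eq_left.2 fun x hx =>
        ⟨h.trans_lt hx.1, hx.2.trans_lt hk⟩
      rw [e, truncation_of_abs_le (by rw [abs_of_nonpos ht]; linarith)]
      simp [ht]
    · have e : Ioc t 0 ∩ Ioo (-k) k = Ioc (-k) 0 := by
        ext x
        exact ⟨fun hx => ⟨hx.2.1, hx.1.2⟩,
          fun hx => ⟨⟨h.trans hx.1, hx.2⟩, hx.1, hx.2.trans_lt hk⟩⟩
      rw [e, truncation, min_eq_left (by linarith), max_eq_left h.le]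
      simp [hk.le]

/-- Smooth approximation of the truncation. -/
noncomputable def smoothTruncation (k : ℝ) (m : ℕ) (t : ℝ) : ℝ := ∫ x in (0 : ℝ)..t, smoothCutoff k m x

theorem hasDerivAt_smoothTruncation (k : ℝ) (m : ℕ) (t : ℝ) :
    HasDerivAt (smoothTruncation k m) (smoothCutoff k m t) t :=
  (contDiff_smoothCutoff k m).continuous.integral_hasStrictDerivAt 0 t |>.hasDerivAt

theorem deriv_smoothTruncation (k : ℝ) (m : ℕ) : deriv (smoothTruncation k m) = smoothCutoff k m :=
  funext fun t => (hasDerivAt_smoothTruncation k m t).deriv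

theorem contDiff_smoothTruncation (k : ℝ) (m : ℕ) : ContDiff ℝ ∞ (smoothTruncation k m) := by
  rw [contDiff_infty_iff_deriv, deriv_smoothTruncation]
  exact ⟨fun t => (hasDerivAt_smoothTruncation k m t).differentiableAt, contDiff_smoothCutoff k m⟩

theorem smoothTruncation_zero (k : ℝ) (m : ℕ) : smoothTruncation k m 0 = 0 :=
  intervalIntegral.integral_same

theorem abs_deriv_smoothTruncation_le (k : ℝ) (m : ℕ) (t : ℝ) :
    |deriv (smoothTruncation k m) t| ≤ 1 := by
  rw [deriv_smoothTruncation, abs_of_nonneg (smoothCutoff_nonneg k m t)]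
  exact smoothCutoff_le_one k m t

theorem abs_smoothTruncation_le (k : ℝ) (m : ℕ) (t : ℝ) : |smoothTruncation k m t| ≤ |t| := by
  simpa [smoothTruncation_zero] using abs_sub_le_of_abs_deriv_le
    ((contDiff_smoothTruncation k m).differentiable (by simp))
    (abs_deriv_smoothTruncation_le k m) t 0

theorem tendsto_smoothTruncation {k : ℝ} (hk : 0 < k) (t : ℝ) :
    Tendsto (fun m => smoothTruncation k m t) atTop (𝓝 (truncation k t)) := by
  rw [← integral_indicator_Ioo_eq_truncation hk]
  refine intervalIntegral.tendsto_integral_filter_of_dominated_convergence (fun _ => 1) ?_ ?_ ?_ ?_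
  · exact Eventually.of_forall fun m => (contDiff_smoothCutoff k m).continuous.aestronglyMeasurable
  · refine Eventually.of_forall fun m => Eventually.of_forall fun x _ => ?_
    rw [Real.norm_of_nonneg (smoothCutoff_nonneg k m x)]
    exact smoothCutoff_le_one k m x
  · exact intervalIntegrable_const
  · exact Eventually.of_forall fun x _ => tendsto_smoothCutoff k x

variable {n : ℕ} {Ω : Set (EuclideanSpace ℝ (Fin n))} {s : ℝ≥0∞}
  {v : EuclideanSpace ℝ (Fin n) → ℝ} {g : EuclideanSpace ℝ (Fin n) → EuclideanSpace ℝ (Fin n)}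

/-- The truncation `T_k v` has gradient `1_{|v| < k} ∇v`. -/
theorem IsTestLimit.truncation (hs : 1 ≤ s) (hs' : s ≠ ⊤) (hv : IsTestLimit Ω s v g) {k : ℝ}
    (hk : 0 < k) :
    IsTestLimit Ω s (fun x => truncation k (v x)) ({x | |v x| < k}.indicator g) := by
  have hs0 : s ≠ 0 := (one_pos.trans_le hs).ne'
  have hmv : AEMeasurable v (volume.restrict Ω) := hv.1.1.aemeasurable
  have hset : {x | |v x| < k} = v ⁻¹' Ioo (-k) k := by ext x; simp [abs_lt]
  have hT : AEStronglyMeasurable (fun x => _root_.truncation k (v x)) (volume.restrict Ω) :=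
    (continuous_truncation k).comp_aestronglyMeasurable hv.1.1
  have hmset : NullMeasurableSet {x | |v x| < k} (volume.restrict Ω) :=
    hset ▸ hmv.nullMeasurableSet_preimage measurableSet_Ioo
  have hG : AEStronglyMeasurable ({x | |v x| < k}.indicator g) (volume.restrict Ω) :=
    hv.2.1.1.indicator₀ hmset
  have hGn : ∀ x, ‖{x | |v x| < k}.indicator g x‖ ≤ ‖g x‖ := fun x =>
    norm_indicator_le_norm_self _ _
  refine isTestLimit_of_tendsto hs (hv.1.mono hT (Eventually.of_forall fun x =>
      abs_truncation_le hk.le)) (hv.2.1.mono hG (Eventually.of_forall hGn))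
    (fun m => hv.comp hs hs' (contDiff_smoothTruncation k m) (smoothTruncation_zero k m)
      (abs_deriv_smoothTruncation_le k m)) ?_ ?_
  · refine tendsto_eLpNorm_zero_of_dominated (h := fun x => (2 : ℝ) • v x) hs0 hs' (fun m => ?_)
      (hv.1.const_smul (2 : ℝ)) (fun m => Eventually.of_forall fun x => ?_)
      (Eventually.of_forall fun x => ?_)
    · exact ((contDiff_smoothTruncation k m).continuous.comp_aestronglyMeasurable hv.1.1).sub hT
    · rw [norm_smul, Real.norm_two, two_mul]
      refine (norm_sub_le _ _).trans (add_le_add ?_ ?_)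
      · exact abs_smoothTruncation_le k m _
      · exact abs_truncation_le hk.le
    · simpa using (tendsto_smoothTruncation hk (v x)).sub_const (_root_.truncation k (v x))
  · simp only [deriv_smoothTruncation]
    refine tendsto_eLpNorm_zero_of_dominated (h := fun x => (2 : ℝ) • g x) hs0 hs' (fun m => ?_)
      (hv.2.1.const_smul (2 : ℝ)) (fun m => Eventually.of_forall fun x => ?_)
      (Eventually.of_forall fun x => ?_)
    · exact (((contDiff_smoothCutoff k m).continuous.comp_aestronglyMeasurable hv.1.1).smul
        hv.2.1.1).sub hG
    · rw [norm_smul, Real.norm_two, two_mul]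
      refine (norm_sub_le _ _).trans (add_le_add ?_ (hGn x))
      rw [norm_smul, Real.norm_of_nonneg (smoothCutoff_nonneg k m _)]
      exact mul_le_of_le_one_left (norm_nonneg _) (smoothCutoff_le_one k m _)
    · have e : {x | |v x| < k}.indicator g x = (Ioo (-k) k).indicator (1 : ℝ → ℝ) (v x) • g x := by
        rw [hset]
        by_cases h : v x ∈ Ioo (-k) k
        · rw [indicator_of_mem h, indicator_of_mem (show x ∈ v ⁻¹' Ioo (-k) k from h), Pi.one_apply,
            one_smul]
        · rw [indicator_of_notMem h, indicator_of_notMem (show x ∉ v ⁻¹' Ioo (-k) k from h), zero_smul]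
      have := ((tendsto_smoothCutoff k (v x)).smul_const (g x)).sub_const
        ({x | |v x| < k}.indicator g x)
      rw [e, sub_self] at this
      simpa only [Pi.sub_apply, e] using this

end Truncation

/-! ### The Sobolev inequality and its level-set form. -/

section Sobolev

/-- The Sobolev inequality `‖v‖_{n/(n-1)} ≤ C ‖∇v‖_1`. -/
theorem exists_sobolev_one_const {n : ℕ} (hn : 2 ≤ n) :
    ∃ C : ℝ≥0, ∀ (Ω : Set (EuclideanSpace ℝ (Fin n))) (s : ℝ≥0∞)
      (v : EuclideanSpace ℝ (Fin n) → ℝ) (g : EuclideanSpace ℝ (Fin n) → EuclideanSpace ℝ (Fin n)),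
      IsFiniteMeasure (volume.restrict Ω) → 1 ≤ s → IsTestLimit Ω s v g →
      eLpNorm v (NNReal.conjExponent n) (volume.restrict Ω) ≤
        C * eLpNorm g 1 (volume.restrict Ω) := by
  have hn1 : (1 : ℝ≥0) < n := by exact_mod_cast hn
  have hp : NNReal.HolderConjugate
      (Module.finrank ℝ (EuclideanSpace ℝ (Fin n))) (NNReal.conjExponent n) := by
    rw [finrank_euclideanSpace_fin]
    exact NNReal.HolderConjugate.conjExponent hn1
  refine ⟨eLpNormLESNormFDerivOneConst (volume : Measure (EuclideanSpace ℝ (Fin n)))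
    (NNReal.conjExponent n : ℝ≥0), fun Ω s v g hfin hs hv => ?_⟩
  obtain ⟨φ, hφ, h₁, h₂, h₃⟩ := hv.exists_seq_ae hs
  replace h₂ :=
    tendsto_eLpNorm_one_of_tendsto_eLpNorm hs hv.2.1 (fun i => (hφ i).memLp_gradient s) h₂
  -- Fatou along the a.e. convergent sequence: no convergence in L^{n/(n-1)} is needed, only
  -- convergence of the gradients in L^1.
  refine (Lp.eLpNorm_lim_le_liminf_eLpNorm (fun i => ((hφ i).memLp s).1) v h₃).trans ?_
  set C := eLpNormLESNormFDerivOneConst (volume : Measure (EuclideanSpace ℝ (Fin n)))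
    (NNReal.conjExponent n : ℝ≥0)
  have hi : ∀ i, eLpNorm (φ i) (NNReal.conjExponent n) (volume.restrict Ω) ≤
      C * (eLpNorm g 1 (volume.restrict Ω) +
        eLpNorm (gradient (φ i) - g) 1 (volume.restrict Ω)) := fun i => by
    refine (eLpNorm_mono_measure _ Measure.restrict_le_self).trans ?_
    refine (eLpNorm_le_eLpNorm_fderiv_one volume ((hφ i).1.of_le (by simp)) (hφ i).2.1 hp).trans ?_
    gcongr
    have e : eLpNorm (fderiv ℝ (φ i)) 1 volume = eLpNorm (gradient (φ i)) 1 (volume.restrict Ω) := by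
      rw [eLpNorm_one_eq_lintegral_enorm, eLpNorm_one_eq_lintegral_enorm]
      simp only [enorm_gradient]
      refine (setLIntegral_eq_of_support_subset fun x hx => ?_).symm
      by_contra hxΩ
      refine hx ?_
      beta_reduce
      rw [← enorm_gradient, (hφ i).gradient_eq_zero_of_notMem hxΩ, enorm_zero]
    rw [e]
    have e' : gradient (φ i) = g + (gradient (φ i) - g) := by abel
    calc eLpNorm (gradient (φ i)) 1 (volume.restrict Ω)
        = eLpNorm (g + (gradient (φ i) - g)) 1 (volume.restrict Ω) := by rw [← e']
      _ ≤ _ := eLpNorm_add_le hv.2.1.1 (((hφ i).memLp_gradient s).1.sub hv.2.1.1) le_rfl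
  have hlim : Tendsto (fun i => C * (eLpNorm g 1 (volume.restrict Ω) +
      eLpNorm (gradient (φ i) - g) 1 (volume.restrict Ω))) atTop
      (𝓝 (C * (eLpNorm g 1 (volume.restrict Ω) + 0))) :=
    ENNReal.Tendsto.const_mul (tendsto_const_nhds.add h₂) (Or.inr ENNReal.coe_ne_top)
  rw [add_zero] at hlim
  rw [← hlim.liminf_eq]
  exact liminf_le_liminf (Eventually.of_forall hi)

/-- Chebyshev's inequality for T_h v - T_k v uses this lower bound to recover the measure of {|v| ≥
h}. -/
theorem sub_le_abs_truncation_sub_truncation {k h t : ℝ} (hk : 0 ≤ k) (hkh : k ≤ h)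
    (ht : h ≤ |t|) : h - k ≤ |truncation h t - truncation k t| := by
  unfold truncation
  rcases le_abs.1 ht with ht | ht
  · rw [min_eq_right ht, min_eq_right (hkh.trans ht), max_eq_right (by linarith),
      max_eq_right (by linarith)]
    exact le_abs_self _
  · rw [min_eq_left (by linarith), min_eq_left (by linarith), max_eq_left (by linarith),
      max_eq_left (by linarith)]
    refine le_trans (by linarith) (neg_le_abs _)

/-- Weak-type Sobolev inequality between two levels of a Sobolev function. -/
theorem exists_levelSet_const {n : ℕ} (hn : 2 ≤ n) :
    ∃ C : ℝ, 0 ≤ C ∧ ∀ (Ω : Set (EuclideanSpace ℝ (Fin n))) (s : ℝ≥0∞)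
      (v : EuclideanSpace ℝ (Fin n) → ℝ) (g : EuclideanSpace ℝ (Fin n) → EuclideanSpace ℝ (Fin n)),
      IsFiniteMeasure (volume.restrict Ω) → 1 ≤ s → s ≠ ⊤ → IsTestLimit Ω s v g →
      ∀ k h : ℝ, 0 < k → k < h →
      (h - k) * (volume.restrict Ω).real {x | h ≤ |v x|} ^ (1 - 1 / (n : ℝ)) ≤
        C * ∫ x in {x | k ≤ |v x| ∧ |v x| < h}, ‖g x‖ ∂(volume.restrict Ω) := by
  obtain ⟨C, hC⟩ := exists_sobolev_one_const hn
  refine ⟨C, C.2, fun Ω s v g hfin hs hs' hv k h hk hkh => ?_⟩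
  set μ := volume.restrict Ω
  have hn1 : (1 : ℝ) < n := by exact_mod_cast hn
  have hT := (hv.truncation hs hs' (hk.trans hkh)).sub hs (hv.truncation hs hs' hk)
  set w : EuclideanSpace ℝ (Fin n) → ℝ :=
    (fun x => truncation h (v x)) - fun x => truncation k (v x) with hw
  have hmS : NullMeasurableSet {x | k ≤ |v x| ∧ |v x| < h} μ := by
    have : AEMeasurable (fun x => |v x|) μ := hv.1.1.aemeasurable.norm
    exact this.nullMeasurableSet_preimage (measurableSet_Ico (a := k) (b := h))
  have hgrad : ({x | |v x| < h}.indicator g - {x | |v x| < k}.indicator g) =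
      {x | k ≤ |v x| ∧ |v x| < h}.indicator g := by
    ext1 x
    simp only [Pi.sub_apply, indicator, mem_ofPred_eq]
    by_cases h₁ : |v x| < k
    · simp [h₁, h₁.trans hkh, not_le.2 h₁]
    · by_cases h₂ : |v x| < h <;> simp [h₁, h₂, not_lt.1 h₁]
  rw [hgrad] at hT
  have hsob := hC Ω s _ _ hfin hs hT
  set p : ℝ≥0∞ := ((NNReal.conjExponent (n : ℝ≥0) : ℝ≥0) : ℝ≥0∞) with hp
  have hptop : p ≠ ⊤ := ENNReal.coe_ne_top
  have hpr : p.toReal = n / (n - 1) := by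
    rw [hp, ENNReal.coe_toReal, NNReal.conjExponent, NNReal.coe_div, NNReal.coe_sub]
    · simp
    · exact_mod_cast hn1.le
  have hpr0 : 0 < p.toReal := by rw [hpr]; exact div_pos (by linarith) (by linarith)
  have hp0 : p ≠ 0 := fun h => by simp [h] at hpr0
  have hmarkov := mul_meas_ge_le_pow_eLpNorm' μ hp0 hptop hT.1.1 (ENNReal.ofReal (h - k))
  have h₁ : ENNReal.ofReal (h - k) * μ {x | h ≤ |v x|} ^ (1 / p.toReal) ≤ eLpNorm w p μ := by
    have := ENNReal.rpow_le_rpow hmarkov (z := 1 / p.toReal) (by positivity)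
    rw [ENNReal.mul_rpow_of_nonneg _ _ (by positivity), ← ENNReal.rpow_mul, ← ENNReal.rpow_mul,
      mul_one_div_cancel hpr0.ne', ENNReal.rpow_one, ENNReal.rpow_one] at this
    refine le_trans ?_ this
    gcongr with x
    intro hx
    rw [← ofReal_norm]
    exact ENNReal.ofReal_le_ofReal (sub_le_abs_truncation_sub_truncation hk.le hkh.le hx)
  have h₂ := h₁.trans hsob
  have hint : Integrable ({x | k ≤ |v x| ∧ |v x| < h}.indicator g) μ := hT.2.1.integrable hs
  rw [eLpNorm_one_eq_lintegral_enorm, ← ofReal_integral_norm_eq_lintegral_enorm hint] at h₂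
  have h₃ := ENNReal.toReal_mono (by finiteness) h₂
  rw [ENNReal.toReal_mul, ENNReal.toReal_mul, ENNReal.toReal_ofReal (by linarith),
    ENNReal.toReal_ofReal (by positivity), ← ENNReal.toReal_rpow] at h₃
  have e : 1 / p.toReal = 1 - 1 / (n : ℝ) := by
    rw [hpr]; field_simp
  rw [e] at h₃
  refine h₃.trans_eq ?_
  simp only [norm_indicator_eq_indicator_norm]
  rw [integral_indicator₀ hmS]
  rfl

end Sobolev

/-! ### Marcinkiewicz bounds and weighted Hölder. -/

section Marcinkiewicz

variable {X : Type*} [MeasurableSpace X] {μ : Measure X}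

/-- A function in the Marcinkiewicz space of exponent `r > 1` satisfies
`∫_A |f| ≤ C |A|^{1 - 1/r}`. -/
theorem exists_lintegral_le_of_meas_gt_le [IsFiniteMeasure μ] {f : X → ℝ} (hf : AEMeasurable f μ)
    {r c : ℝ} (hr : 1 < r) (hc : 0 ≤ c)
    (hfr : ∀ t : ℝ, 0 < t → μ {x | t < |f x|} ≤ ENNReal.ofReal (c / t ^ r)) (A : Set X) :
    ∫⁻ x in A, ENNReal.ofReal |f x| ∂μ ≤
      ENNReal.ofReal ((1 + c / (r - 1)) * μ.real A ^ (1 - 1 / r)) := by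
  rcases eq_or_ne (μ A) 0 with hA | hA
  · rw [Measure.restrict_eq_zero.2 hA]; simp
  have hm : 0 < μ.real A := ENNReal.toReal_pos hA (measure_ne_top _ _)
  set m := μ.real A with hm_def
  -- This height balances the two parts of the layer-cake integral: below T the level sets are
  -- bounded by |A|, above T by c t^{-r}, and both contributions scale like |A|^{1-1/r}.
  set T : ℝ := m ^ (-(1 / r)) with hT
  have hT0 : 0 < T := Real.rpow_pos_of_pos hm _
  rw [lintegral_eq_lintegral_meas_lt _ (Eventually.of_forall fun x => abs_nonneg (f x))
    hf.restrict.norm, ← Ioc_union_Ioi_eq_Ioi hT0.le,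
    lintegral_union measurableSet_Ioi (Ioc_disjoint_Ioi le_rfl)]
  have h₁ : ∫⁻ t in Ioc 0 T, (μ.restrict A) {x | t < |f x|} ≤ ENNReal.ofReal (m * T) := by
    calc ∫⁻ t in Ioc 0 T, (μ.restrict A) {x | t < |f x|}
        ≤ ∫⁻ _ in Ioc 0 T, μ A := lintegral_mono fun t => by
          rw [← Measure.restrict_apply_univ A]; exact measure_mono (subset_univ _)
      _ = ENNReal.ofReal (m * T) := by
          rw [setLIntegral_const, Real.volume_Ioc, sub_zero, ENNReal.ofReal_mul hm.le, hm_def,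
            ofReal_measureReal]
  have h₂ : ∫⁻ t in Ioi T, (μ.restrict A) {x | t < |f x|} ≤
      ENNReal.ofReal (c / (r - 1) * T ^ (1 - r)) := by
    have hi : IntegrableOn (fun t : ℝ => c * t ^ (-r)) (Ioi T) :=
      (integrableOn_Ioi_rpow_of_lt (by linarith) hT0).const_mul c
    have hval : ∫ t in Ioi T, c * t ^ (-r) = c / (r - 1) * T ^ (1 - r) := by
      rw [integral_const_mul, integral_Ioi_rpow_of_lt (by linarith) hT0,
        show -r + 1 = -(r - 1) by ring, neg_div_neg_eq, show -(r - 1) = 1 - r by ring]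
      ring
    rw [← hval, ofReal_integral_eq_lintegral_ofReal hi]
    · refine setLIntegral_mono' measurableSet_Ioi fun t ht => ?_
      have ht0 : 0 < t := hT0.trans ht
      refine (Measure.restrict_le_self _).trans ((hfr t ht0).trans_eq ?_)
      rw [Real.rpow_neg ht0.le, div_eq_mul_inv]
    · refine (ae_restrict_iff' measurableSet_Ioi).2 (Eventually.of_forall fun t ht => ?_)
      have ht0 : 0 < t := hT0.trans ht
      positivity
  refine (add_le_add h₁ h₂).trans ?_
  have hr1 : 0 < r - 1 := by linarith
  rw [← ENNReal.ofReal_add (by positivity) (by positivity)]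
  refine ENNReal.ofReal_le_ofReal (le_of_eq ?_)
  have e₁ : m * T = m ^ (1 - 1 / r) := by
    rw [hT, sub_eq_add_neg, Real.rpow_add hm, Real.rpow_one]
  have e₂ : T ^ (1 - r) = m ^ (1 - 1 / r) := by
    rw [hT, ← Real.rpow_mul hm.le]
    congr 1
    field_simp
    ring
  rw [e₁, e₂]
  ring

theorem integrable_of_meas_gt_le [IsFiniteMeasure μ] {f : X → ℝ} (hf : AEMeasurable f μ)
    {r c : ℝ} (hr : 1 < r) (hc : 0 ≤ c)
    (hfr : ∀ t : ℝ, 0 < t → μ {x | t < |f x|} ≤ ENNReal.ofReal (c / t ^ r)) :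
    Integrable f μ := by
  refine ⟨hf.aestronglyMeasurable, ?_⟩
  have := exists_lintegral_le_of_meas_gt_le hf hr hc hfr univ
  rw [Measure.restrict_univ] at this
  rw [hasFiniteIntegral_iff_norm]
  exact this.trans_lt ENNReal.ofReal_lt_top

theorem setIntegral_abs_le_of_meas_gt_le [IsFiniteMeasure μ] {f : X → ℝ} (hf : AEMeasurable f μ)
    {r c : ℝ} (hr : 1 < r) (hc : 0 ≤ c)
    (hfr : ∀ t : ℝ, 0 < t → μ {x | t < |f x|} ≤ ENNReal.ofReal (c / t ^ r)) (A : Set X) :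
    ∫ x in A, |f x| ∂μ ≤ (1 + c / (r - 1)) * μ.real A ^ (1 - 1 / r) := by
  have hr1 : 0 < r - 1 := by linarith
  rw [integral_eq_lintegral_of_nonneg_ae (Eventually.of_forall fun x => abs_nonneg (f x))
    hf.norm.aestronglyMeasurable.restrict]
  exact ENNReal.toReal_le_of_le_ofReal (by positivity)
    (exists_lintegral_le_of_meas_gt_le hf hr hc hfr A)

/-- Weighted Hölder inequality: `∫_S G ≤ (∫_S G^p / W^{αp})^{1/p} (∫_S W^{αp'})^{1/p'}`. -/
theorem setIntegral_le_weighted_holder {G W : X → ℝ} {p p' α : ℝ} (hpp : p.HolderConjugate p')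
    (hG : AEMeasurable G μ) (hG0 : ∀ x, 0 ≤ G x) (hW : AEMeasurable W μ) (hW0 : ∀ x, 0 < W x)
    (hP : Integrable (fun x => G x ^ p / W x ^ (α * p)) μ)
    (hQ : Integrable (fun x => W x ^ (α * p')) μ) (S : Set X) :
    ∫ x in S, G x ∂μ ≤ (∫ x in S, G x ^ p / W x ^ (α * p) ∂μ) ^ (1 / p) *
      (∫ x in S, W x ^ (α * p') ∂μ) ^ (1 / p') := by
  -- Ordinary Hölder for the factorization G = (G / W^α) · W^α.
  have e₁ : ∀ x, (G x / W x ^ α) ^ p = G x ^ p / W x ^ (α * p) := fun x => by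
    rw [Real.div_rpow (hG0 x) (Real.rpow_nonneg (hW0 x).le _), ← Real.rpow_mul (hW0 x).le]
  have e₂ : ∀ x, (W x ^ α) ^ p' = W x ^ (α * p') := fun x => by
    rw [← Real.rpow_mul (hW0 x).le]
  have e₃ : ∀ x, G x / W x ^ α * W x ^ α = G x := fun x =>
    div_mul_cancel₀ _ (Real.rpow_pos_of_pos (hW0 x) _).ne'
  have h₁ : ∀ x, 0 ≤ G x / W x ^ α := fun x => div_nonneg (hG0 x) (Real.rpow_nonneg (hW0 x).le _)
  have h₂ : ∀ x, 0 ≤ W x ^ α := fun x => Real.rpow_nonneg (hW0 x).le _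
  have memLp : ∀ {f : X → ℝ} {s : ℝ}, 0 < s → AEMeasurable f μ → (∀ x, 0 ≤ f x) →
      Integrable (fun x => f x ^ s) μ → MemLp f (ENNReal.ofReal s) (μ.restrict S) := by
    intro f s hs hf hf0 hi
    refine MemLp.restrict S ?_
    rw [← integrable_norm_rpow_iff hf.aestronglyMeasurable (by simpa using hs)
      ENNReal.ofReal_ne_top, ENNReal.toReal_ofReal hs.le]
    simpa only [Real.norm_of_nonneg (hf0 _)] using hi
  have := integral_mul_le_Lp_mul_Lq_of_nonneg (μ := μ.restrict S) hpp
    (Eventually.of_forall h₁) (Eventually.of_forall h₂)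
    (memLp hpp.pos (hG.div (hW.pow_const _)) h₁ (by simpa only [e₁] using hP))
    (memLp hpp.symm.pos (hW.pow_const _) h₂ (by simpa only [e₂] using hQ))
  simpa only [e₁, e₂, e₃] using this

end Marcinkiewicz

/-! ### Two inequalities behind the geometric decay. -/

section Sequences

/-- A sequence controlled by a quarter of itself and by an error term whose tails are controlled
by its own tails decays geometrically. -/
theorem exists_le_mul_half_pow {x y : ℕ → ℝ} {c D : ℝ} (hx : ∀ m, 0 ≤ x m) (hy : ∀ m, 0 ≤ y m)
    (hc : 0 ≤ c) (hcD : c * D ≤ 1 / 4) (hys : Summable y)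
    (hxy : ∀ m, x (m + 1) ≤ 1 / 4 * x m + c * y m)
    (htail : Summable x → ∀ N, ∑' m, y (m + N) ≤ D * ∑' m, x (m + N)) :
    ∃ C, 0 ≤ C ∧ ∀ m, x m ≤ C * (1 / 2) ^ m := by
  have hxs : Summable x := by
    -- Summability must come first, since the tail comparison is available only for summable x.
    -- Summing the recursion over m < N, the term with factor 1/4 is absorbed, which leaves the
    -- factor 4/3.
    refine summable_of_sum_range_le (c := 4 / 3 * (x 0 + c * ∑' m, y m)) hx fun N => ?_
    have h₁ : ∑ m ∈ Finset.range N, x m ≤ ∑ m ∈ Finset.range (N + 1), x m :=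
      Finset.sum_le_sum_of_subset_of_nonneg (Finset.range_mono (Nat.le_succ N)) fun i _ _ => hx i
    have h₂ : ∑ m ∈ Finset.range N, x (m + 1) ≤
        1 / 4 * ∑ m ∈ Finset.range N, x m + c * ∑ m ∈ Finset.range N, y m := by
      rw [Finset.mul_sum, Finset.mul_sum, ← Finset.sum_add_distrib]
      exact Finset.sum_le_sum fun m _ => hxy m
    have h₃ : c * ∑ m ∈ Finset.range N, y m ≤ c * ∑' m, y m :=
      mul_le_mul_of_nonneg_left (hys.sum_le_tsum _ fun i _ => hy i) hc
    rw [Finset.sum_range_succ'] at h₁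
    linarith
  have hxN : ∀ N, Summable fun m => x (m + N) := fun N => (summable_nat_add_iff N).2 hxs
  have hyN : ∀ N, Summable fun m => y (m + N) := fun N => (summable_nat_add_iff N).2 hys
  have h0 : ∀ N, 0 ≤ ∑' m, x (m + N) := fun N => tsum_nonneg fun m => hx _
  -- Summed over m ≥ N, the recursion bounds the next tail by (1/4 + cD) times the present one, and
  -- cD ≤ 1/4.
  have hstep : ∀ N, ∑' m, x (m + (N + 1)) ≤ 1 / 2 * ∑' m, x (m + N) := fun N => by
    have h₁ : ∑' m, x (m + (N + 1)) ≤ ∑' m, (1 / 4 * x (m + N) + c * y (m + N)) :=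
      (hxN (N + 1)).tsum_le_tsum (fun m => hxy (m + N))
        (((hxN N).mul_left _).add ((hyN N).mul_left _))
    rw [((hxN N).mul_left _).tsum_add ((hyN N).mul_left _), tsum_mul_left, tsum_mul_left] at h₁
    have h₂ := mul_le_mul_of_nonneg_left (htail hxs N) hc
    have h₃ := mul_le_mul_of_nonneg_right hcD (h0 N)
    linarith
  have hdecay : ∀ N, ∑' m, x (m + N) ≤ (∑' m, x m) * (1 / 2) ^ N := fun N => by
    induction N with
    | zero => simp
    | succ N ih => rw [pow_succ]; linarith [hstep N]
  refine ⟨∑' m, x m, tsum_nonneg hx, fun N => le_trans ?_ (hdecay N)⟩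
  simpa using (hxN N).le_tsum 0 fun i _ => hx _

/-- Absorption inequality used on consecutive level sets. -/
theorem rpow_le_absorb {d p η K g x y : ℝ} (hp : 1 < p) (hpd : p < d) (hη : 0 < η)
    (hK : 0 ≤ K) (hg : 0 < g) (hx : 0 ≤ x) (hy : 0 ≤ y)
    (h : g * x ^ (1 - 1 / d) ≤ K * y ^ (1 - 1 / p)) :
    x ^ (1 - p / d) ≤ η * y ^ (1 - p / d) +
      (η⁻¹ ^ (1 / (1 - p / d))) ^ (p - 1) * (K / g) ^ p := by
  have hd : 0 < d := by linarith
  have hs : 0 < 1 - p / d := by rw [sub_pos, div_lt_one hd]; exact hpd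
  set H := η⁻¹ ^ (1 / (1 - p / d)) with hH
  have hH0 : 0 < H := Real.rpow_pos_of_pos (inv_pos.2 hη) _
  -- Either the first term on the right suffices, or y ≤ H x; then the hypothesis involves x alone,
  -- and dividing by x^{1-1/p} and raising to the power p gives the second term.
  rcases le_or_gt (x ^ (1 - p / d)) (η * y ^ (1 - p / d)) with hcase | hcase
  · have : 0 ≤ H ^ (p - 1) * (K / g) ^ p := by positivity
    linarith
  have hx0 : 0 < x := by
    rcases hx.eq_or_lt with h0 | h0
    · rw [← h0, Real.zero_rpow hs.ne'] at hcase
      exact absurd hcase (not_lt.2 (by positivity))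
    · exact h0
  have hyx : y ≤ H * x := by
    have h₁ : y ^ (1 - p / d) ≤ (H * x) ^ (1 - p / d) := by
      rw [Real.mul_rpow hH0.le hx, hH, ← Real.rpow_mul (inv_pos.2 hη).le, one_div_mul_cancel hs.ne',
        Real.rpow_one, inv_mul_eq_div, le_div_iff₀ hη]
      linarith
    exact (Real.rpow_le_rpow_iff hy (by positivity) hs).1 h₁
  have hp1 : 0 ≤ 1 - 1 / p := by
    rw [sub_nonneg, div_le_one (by linarith)]; exact hp.le
  have h₂ : g * x ^ (1 - 1 / d) ≤ K * (H ^ (1 - 1 / p) * x ^ (1 - 1 / p)) := by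
    rw [← Real.mul_rpow hH0.le hx]
    exact h.trans (mul_le_mul_of_nonneg_left (Real.rpow_le_rpow hy hyx hp1) hK)
  have h₃ : x ^ (1 / p - 1 / d) ≤ H ^ (1 - 1 / p) * (K / g) := by
    have e : x ^ (1 - 1 / d) = x ^ (1 / p - 1 / d) * x ^ (1 - 1 / p) := by
      rw [← Real.rpow_add hx0]; congr 1; ring
    rw [e] at h₂
    have hxp : 0 < x ^ (1 - 1 / p) := Real.rpow_pos_of_pos hx0 _
    rw [mul_div_assoc', le_div_iff₀ hg]
    refine le_of_mul_le_mul_right ?_ hxp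
    linarith
  have h₄ := Real.rpow_le_rpow (Real.rpow_nonneg hx _) h₃ (by linarith : 0 ≤ p)
  rw [← Real.rpow_mul hx, Real.mul_rpow (by positivity) (by positivity),
    ← Real.rpow_mul hH0.le] at h₄
  have e₁ : (1 / p - 1 / d) * p = 1 - p / d := by field_simp
  have e₂ : (1 - 1 / p) * p = p - 1 := by field_simp
  rw [e₁, e₂] at h₄
  have : 0 ≤ η * y ^ (1 - p / d) := by positivity
  linarith

end Sequences

/-! ### Gaps and weights of the levels Λ(m+1)^σ. -/

section Chain

theorem rpow_le_sub_rpow_succ {σ t : ℝ} (hσ : 1 ≤ σ) (ht : 0 < t) :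
    t ^ (σ - 1) ≤ (t + 1) ^ σ - t ^ σ := by
  have h₁ : (t + 1) ^ σ = (t + 1) ^ (σ - 1) * (t + 1) := by
    rw [← Real.rpow_add_one (by positivity)]; congr 1; ring
  have h₂ : t ^ σ = t ^ (σ - 1) * t := by
    rw [← Real.rpow_add_one ht.ne']; congr 1; ring
  have h₃ : t ^ (σ - 1) ≤ (t + 1) ^ (σ - 1) :=
    Real.rpow_le_rpow ht.le (by linarith) (by linarith)
  rw [h₁, h₂]
  nlinarith

/-- Bernoulli's inequality for (t/(t+1))^σ = (1 - 1/(t+1))^σ, multiplied by (t+1)^σ. -/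
theorem sub_rpow_succ_le {σ t : ℝ} (hσ : 1 ≤ σ) (ht : 0 < t) :
    (t + 1) ^ σ - t ^ σ ≤ σ * (t + 1) ^ (σ - 1) := by
  have ht1 : 0 < t + 1 := by linarith
  have hb := one_add_mul_self_le_rpow_one_add (s := -1 / (t + 1)) (p := σ)
    (by rw [le_div_iff₀ ht1]; linarith) hσ
  have e₁ : 1 + -1 / (t + 1) = t / (t + 1) := by field_simp; ring
  rw [e₁, Real.div_rpow ht.le ht1.le, le_div_iff₀ (by positivity)] at hb
  have h₁ : (t + 1) ^ σ = (t + 1) ^ (σ - 1) * (t + 1) := by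
    rw [← Real.rpow_add_one (by positivity)]; congr 1; ring
  have e₂ : (1 + σ * (-1 / (t + 1))) * (t + 1) ^ σ = (t + 1) ^ σ - σ * (t + 1) ^ (σ - 1) := by
    rw [h₁]; field_simp; ring
  linarith

/-- The gaps of the levels `Λ (m + 1)^σ` grow in a controlled way. -/
theorem level_gap_le {Λ σ : ℝ} (hΛ : 0 < Λ) (hσ : 1 ≤ σ) (m : ℕ) :
    Λ * ((m + 1 : ℕ) + 1 + 1 : ℝ) ^ σ - Λ * ((m + 1 : ℕ) + 1 : ℝ) ^ σ ≤
      σ * 3 ^ (σ - 1) * (Λ * ((m : ℝ) + 1 + 1) ^ σ - Λ * ((m : ℝ) + 1) ^ σ) := by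
  have hm : (0 : ℝ) < m + 1 := by positivity
  have h₁ := sub_rpow_succ_le (t := ((m + 1 : ℕ) + 1 : ℝ)) hσ (by positivity)
  have h₂ := rpow_le_sub_rpow_succ hσ hm
  have h₃ : ((m + 1 : ℕ) + 1 + 1 : ℝ) ^ (σ - 1) ≤ 3 ^ (σ - 1) * ((m : ℝ) + 1) ^ (σ - 1) := by
    rw [← Real.mul_rpow (by norm_num) hm.le]
    refine Real.rpow_le_rpow (by positivity) ?_ (by linarith)
    push_cast
    linarith [(Nat.cast_nonneg m : (0 : ℝ) ≤ m)]
  rw [← mul_sub, ← mul_sub]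
  calc Λ * (((m + 1 : ℕ) + 1 + 1 : ℝ) ^ σ - ((m + 1 : ℕ) + 1 : ℝ) ^ σ)
      ≤ Λ * (σ * (3 ^ (σ - 1) * ((m : ℝ) + 1) ^ (σ - 1))) := by
        refine mul_le_mul_of_nonneg_left (h₁.trans ?_) hΛ.le
        exact mul_le_mul_of_nonneg_left h₃ (by linarith)
    _ ≤ Λ * (σ * (3 ^ (σ - 1) * (((m : ℝ) + 1 + 1) ^ σ - ((m : ℝ) + 1) ^ σ))) := by
        gcongr
    _ = _ := by ring

/-- The weight on the level `Λ (m + 2)^σ` is compensated by the gap. -/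
theorem level_weight_le {Λ B σ p β : ℝ} (hβ0 : 0 < β) (hβ : β < p - 1)
    (hσ : σ = (p - 1) / (p - 1 - β)) (hB : 0 < B) (hBΛ : B ≤ Λ) (m : ℕ) :
    (B + Λ * ((m : ℝ) + 1 + 1) ^ σ) ^ β *
        (Λ * ((m : ℝ) + 1 + 1) ^ σ - Λ * ((m : ℝ) + 1) ^ σ) ^ (1 - p) ≤
      (2 ^ (σ + 1)) ^ β * Λ ^ (-(p - 1 - β)) := by
  have hpb : 0 < p - 1 - β := by linarith
  have hσ1 : 1 ≤ σ := by rw [hσ, le_div_iff₀ hpb]; linarith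
  have hΛ : 0 < Λ := hB.trans_le hBΛ
  have hm : (0 : ℝ) < m + 1 := by positivity
  set t : ℝ := (m : ℝ) + 1 with ht
  have ht1 : 1 ≤ t := by simp [ht]
  have h₁ : B + Λ * (t + 1) ^ σ ≤ 2 ^ (σ + 1) * (Λ * t ^ σ) := by
    have a₁ : (t + 1) ^ σ ≤ 2 ^ σ * t ^ σ := by
      rw [← Real.mul_rpow (by norm_num) hm.le]
      exact Real.rpow_le_rpow (by positivity) (by linarith) (by linarith)
    have a₂ : 1 ≤ (t + 1) ^ σ := Real.one_le_rpow (by linarith) (by linarith)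
    rw [Real.rpow_add_one (by norm_num)]
    calc B + Λ * (t + 1) ^ σ ≤ Λ * (t + 1) ^ σ + Λ * (t + 1) ^ σ := by nlinarith
      _ = 2 * (Λ * (t + 1) ^ σ) := by ring
      _ ≤ 2 * (Λ * (2 ^ σ * t ^ σ)) := by gcongr
      _ = _ := by ring
  have h₂ : Λ * t ^ (σ - 1) ≤ Λ * (t + 1) ^ σ - Λ * t ^ σ := by
    rw [← mul_sub]
    exact mul_le_mul_of_nonneg_left (rpow_le_sub_rpow_succ hσ1 hm) hΛ.le
  have h₃ : (Λ * (t + 1) ^ σ - Λ * t ^ σ) ^ (1 - p) ≤ (Λ * t ^ (σ - 1)) ^ (1 - p) :=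
    Real.rpow_le_rpow_of_nonpos (by positivity) h₂ (by linarith)
  have h₄ : (B + Λ * (t + 1) ^ σ) ^ β ≤ (2 ^ (σ + 1) * (Λ * t ^ σ)) ^ β :=
    Real.rpow_le_rpow (by positivity) h₁ hβ0.le
  refine (mul_le_mul h₄ h₃ (Real.rpow_nonneg (le_trans (by positivity) h₂) _)
    (by positivity)).trans_eq ?_
  rw [Real.mul_rpow (by positivity) (by positivity), Real.mul_rpow hΛ.le (by positivity),
    Real.mul_rpow hΛ.le (by positivity), ← Real.rpow_mul hm.le, ← Real.rpow_mul hm.le]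
  -- The choice of σ is exactly the cancellation σβ = (σ-1)(p-1), which removes all dependence on m.
  have e₁ : t ^ (σ * β) * t ^ ((σ - 1) * (1 - p)) = 1 := by
    rw [← Real.rpow_add hm]
    have : σ * β + (σ - 1) * (1 - p) = 0 := by rw [hσ]; field_simp; ring
    rw [this, Real.rpow_zero]
  have e₂ : Λ ^ β * Λ ^ (1 - p) = Λ ^ (-(p - 1 - β)) := by
    rw [← Real.rpow_add hΛ]; congr 1; ring
  calc _ = (2 ^ (σ + 1)) ^ β * (Λ ^ β * Λ ^ (1 - p)) *
        (t ^ (σ * β) * t ^ ((σ - 1) * (1 - p))) := by ring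
    _ = _ := by rw [e₁, e₂, mul_one]

end Chain

/-! ### Geometric decay of the level sets at critical integrability. -/

section Decay

variable {X : Type*} [MeasurableSpace X] {μ : Measure X} {U F P : X → ℝ}

theorem nullMeasurableSet_level (hU : AEMeasurable U μ) (k : ℝ) :
    NullMeasurableSet {x | k ≤ U x} μ :=
  hU.nullMeasurableSet_preimage measurableSet_Ici

theorem setIntegral_level_eq_add (hU : AEMeasurable U μ) (hP : Integrable P μ) {k h : ℝ}
    (hkh : k ≤ h) :
    ∫ x in {x | k ≤ U x}, P x ∂μ =
      ∫ x in {x | k ≤ U x ∧ U x < h}, P x ∂μ + ∫ x in {x | h ≤ U x}, P x ∂μ := by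
  have e : {x | k ≤ U x} = {x | k ≤ U x ∧ U x < h} ∪ {x | h ≤ U x} := by
    ext x
    constructor
    · intro hx
      rcases lt_or_ge (U x) h with h' | h'
      · exact Or.inl ⟨hx, h'⟩
      · exact Or.inr h'
    · rintro (hx | hx)
      · exact hx.1
      · exact hkh.trans hx
  rw [e]
  refine setIntegral_union₀ ?_ (nullMeasurableSet_level hU h) hP.integrableOn hP.integrableOn
  refine (Set.disjoint_left.2 fun x hx hx' => ?_).aedisjoint
  exact absurd hx.2 (not_lt.2 hx')

/-- The strips are disjoint pieces of {U ≥ k_N}; with the remaining set {U ≥ k_{J+N}} the sum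
telescopes to an equality. -/
theorem sum_setIntegral_level_le (hU : AEMeasurable U μ) (hP : Integrable P μ)
    (hP0 : ∀ x, 0 ≤ P x) {k : ℕ → ℝ} (hk : Monotone k) (N J : ℕ) :
    ∑ m ∈ Finset.range J, ∫ x in {x | k (m + N) ≤ U x ∧ U x < k (m + N + 1)}, P x ∂μ ≤
      ∫ x in {x | k N ≤ U x}, P x ∂μ := by
  have key : ∑ m ∈ Finset.range J, ∫ x in {x | k (m + N) ≤ U x ∧ U x < k (m + N + 1)}, P x ∂μ +
      ∫ x in {x | k (J + N) ≤ U x}, P x ∂μ = ∫ x in {x | k N ≤ U x}, P x ∂μ := by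
    induction J with
    | zero => simp
    | succ J ih =>
      rw [Finset.sum_range_succ, ← ih, setIntegral_level_eq_add hU hP (hk (Nat.le_succ (J + N)))]
      rw [show J + 1 + N = J + N + 1 by ring, Nat.succ_eq_add_one]
      ring
  have : 0 ≤ ∫ x in {x | k (J + N) ≤ U x}, P x ∂μ := integral_nonneg hP0
  linarith

/-- Dominated by FU, and at each point the integrand vanishes as soon as k_m exceeds U. This
disposes of the remainder in the layer-cake iteration. -/
theorem tendsto_setIntegral_level_sub (hU : AEMeasurable U μ) (hU0 : ∀ x, 0 ≤ U x)
    (hF : Integrable F μ) (hF0 : ∀ x, 0 ≤ F x)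
    (hFU : Integrable (fun x => F x * U x) μ) {k : ℕ → ℝ} (hk0 : ∀ m, 0 ≤ k m)
    (hk : Tendsto k atTop atTop) :
    Tendsto (fun m => ∫ x in {x | k m ≤ U x}, F x * (U x - k m) ∂μ) atTop (𝓝 0) := by
  have e : ∀ m, ∫ x in {x | k m ≤ U x}, F x * (U x - k m) ∂μ =
      ∫ x, {x | k m ≤ U x}.indicator (fun x => F x * (U x - k m)) x ∂μ := fun m =>
    (integral_indicator₀ (nullMeasurableSet_level hU _)).symm
  simp only [e]
  rw [← integral_zero X ℝ (μ := μ)]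
  refine tendsto_integral_of_dominated_convergence (fun x => F x * U x) (fun m => ?_) hFU
    (fun m => Eventually.of_forall fun x => ?_) (Eventually.of_forall fun x => ?_)
  · exact (hF.1.mul (hU.aestronglyMeasurable.sub aestronglyMeasurable_const)).indicator₀
      (nullMeasurableSet_level hU _)
  · by_cases hx : k m ≤ U x
    · rw [indicator_of_mem (show x ∈ {x | k m ≤ U x} from hx),
        Real.norm_of_nonneg (mul_nonneg (hF0 x) (sub_nonneg.2 hx))]
      exact mul_le_mul_of_nonneg_left (by linarith [hk0 m]) (hF0 x)
    · rw [indicator_of_notMem (show x ∉ {x | k m ≤ U x} from hx), norm_zero]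
      exact mul_nonneg (hF0 x) (hU0 x)
  · refine tendsto_nhds_of_eventually_eq ?_
    filter_upwards [hk.eventually_gt_atTop (U x)] with m hm
    exact indicator_of_notMem (show x ∉ {x | k m ≤ U x} from not_le.2 hm) _

/-- Layer-cake type bound of `∫_{U ≥ k_N} F (U - k_N)` along a sequence of levels. -/
theorem setIntegral_level_sub_le_tsum (hU : AEMeasurable U μ) (hU0 : ∀ x, 0 ≤ U x)
    (hF : Integrable F μ) (hF0 : ∀ x, 0 ≤ F x)
    (hFU : Integrable (fun x => F x * U x) μ) {k : ℕ → ℝ} (hk0 : ∀ m, 0 ≤ k m)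
    (hkm : Monotone k) (hk : Tendsto k atTop atTop) {z : ℕ → ℝ} (hz0 : ∀ m, 0 ≤ z m)
    (hz : ∀ m, (k (m + 1) - k m) * ∫ x in {x | k m ≤ U x}, F x ∂μ ≤ z m) (hzs : Summable z)
    (N : ℕ) :
    ∫ x in {x | k N ≤ U x}, F x * (U x - k N) ∂μ ≤ ∑' m, z (m + N) := by
  set R : ℕ → ℝ := fun m => ∫ x in {x | k m ≤ U x}, F x * (U x - k m) ∂μ with hR
  have hint : ∀ c : ℝ, Integrable (fun x => F x * (U x - c)) μ := fun c => by
    simp only [mul_sub]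
    exact hFU.sub (hF.mul_const c)
  -- On the strip U - k_m is at most the gap; above k_{m+1} it is the gap plus U - k_{m+1}. So R m
  -- is at most the gap times ∫_{U ≥ k_m} F, plus R (m+1).
  have hstep : ∀ m, R m ≤ z m + R (m + 1) := fun m => by
    refine le_trans ?_ (add_le_add (hz m) le_rfl)
    have hkk := hkm (Nat.le_succ m)
    simp only [hR]
    rw [setIntegral_level_eq_add hU (hint (k m)) hkk, Nat.succ_eq_add_one]
    have h₁ : ∫ x in {x | k (m + 1) ≤ U x}, F x * (U x - k m) ∂μ =
        (k (m + 1) - k m) * ∫ x in {x | k (m + 1) ≤ U x}, F x ∂μ +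
          ∫ x in {x | k (m + 1) ≤ U x}, F x * (U x - k (m + 1)) ∂μ := by
      rw [← integral_const_mul, ← integral_add (hF.const_mul _).integrableOn
        (hint _).integrableOn]
      exact integral_congr_ae (Eventually.of_forall fun x => by ring)
    have h₂ : ∫ x in {x | k m ≤ U x ∧ U x < k (m + 1)}, F x * (U x - k m) ∂μ ≤
        (k (m + 1) - k m) * ∫ x in {x | k m ≤ U x ∧ U x < k (m + 1)}, F x ∂μ := by
      rw [← integral_const_mul]
      have hS : NullMeasurableSet {x | k m ≤ U x ∧ U x < k (m + 1)} μ :=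
        hU.nullMeasurableSet_preimage (measurableSet_Ico (a := k m) (b := k (m + 1)))
      refine setIntegral_mono_on_ae₀ (hint _).integrableOn (hF.const_mul _).integrableOn hS
        (Eventually.of_forall fun x hx => ?_)
      rw [mul_comm]
      exact mul_le_mul_of_nonneg_right (by linarith [hx.2]) (hF0 x)
    rw [h₁, setIntegral_level_eq_add hU hF hkk, Nat.succ_eq_add_one, mul_add]
    linarith
  have hsum : ∀ J, R N ≤ ∑' m, z (m + N) + R (J + N) := fun J => by
    have : R N ≤ ∑ m ∈ Finset.range J, z (m + N) + R (J + N) := by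
      induction J with
      | zero => simp
      | succ J ih =>
        rw [Finset.sum_range_succ]
        have := hstep (J + N)
        rw [show J + 1 + N = J + N + 1 by ring]
        linarith
    have h' := ((summable_nat_add_iff N).2 hzs).sum_le_tsum (Finset.range J) fun i _ => hz0 _
    linarith
  have hlim : Tendsto (fun J => ∑' m, z (m + N) + R (J + N)) atTop
      (𝓝 (∑' m, z (m + N) + 0)) :=
    tendsto_const_nhds.add
      ((tendsto_add_atTop_iff_nat N).2 (tendsto_setIntegral_level_sub hU hU0 hF hF0 hFU hk0 hk))
  rw [add_zero] at hlim
  exact ge_of_tendsto' hlim hsum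

variable {G : X → ℝ}

/-- Decay of the level sets of a function satisfying the level set estimates of a minimum, at the
critical integrability of the datum. -/
theorem exists_geometric_decay [IsFiniteMeasure μ] {d p p' α B C₁ C₂ C₃ : ℝ}
    (hpp : p.HolderConjugate p') (hpd : p < d) (hα0 : 0 < α) (hα1 : α * p' < 1) (hB : 0 < B)
    (hC₁ : 0 ≤ C₁) (hC₂ : 0 ≤ C₂) (hC₃ : 0 ≤ C₃)
    (hU : Integrable U μ) (hU0 : ∀ x, 0 ≤ U x) (hG : AEMeasurable G μ) (hG0 : ∀ x, 0 ≤ G x)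
    (hP : Integrable (fun x => G x ^ p / (B + U x) ^ (α * p)) μ)
    (hF : Integrable F μ) (hF0 : ∀ x, 0 ≤ F x) (hFU : Integrable (fun x => F x * U x) μ)
    (hlevel : ∀ k h : ℝ, 0 < k → k < h → (h - k) * μ.real {x | h ≤ U x} ^ (1 - 1 / d) ≤
      C₁ * ∫ x in {x | k ≤ U x ∧ U x < h}, G x ∂μ)
    (hmin : ∀ k : ℝ, 0 < k → ∫ x in {x | k ≤ U x}, G x ^ p / (B + U x) ^ (α * p) ∂μ ≤
      C₂ * ∫ x in {x | k ≤ U x}, F x * (U x - k) ∂μ)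
    (hmar : ∀ A : Set X, ∫ x in A, F x ∂μ ≤ C₃ * μ.real A ^ (1 - p / d)) :
    ∃ Λ θ C : ℝ, 0 < Λ ∧ 0 < θ ∧ θ < 1 ∧ 0 ≤ C ∧ ∀ m : ℕ,
      μ.real {x | Λ * ((m : ℝ) + 1) ^ (1 / (1 - α * p')) ≤ U x} ≤ C * θ ^ m := by
  have hp := hpp.lt
  have hp0 := hpp.pos
  have hp'0 := hpp.symm.pos
  have hd : 0 < d := hp0.trans hpd
  have hp1 : 0 < p - 1 := by linarith
  have hp'eq : p' = p / (p - 1) := hpp.conjugate_eq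
  have hβ0 : 0 < α * p := by positivity
  have hβ : α * p < p - 1 := by
    rw [hp'eq, mul_div_assoc', div_lt_one hp1] at hα1
    exact hα1
  have hpb : 0 < p - 1 - α * p := by linarith
  have hexp : 1 - α * p' = (p - 1 - α * p) / (p - 1) := by
    rw [hp'eq]; field_simp
  set σ : ℝ := 1 / (1 - α * p') with hσdef
  have hσ : σ = (p - 1) / (p - 1 - α * p) := by rw [hσdef, hexp, one_div_div]
  have hσ1 : 1 ≤ σ := by rw [hσ, le_div_iff₀ hpb]; linarith
  have hs : 0 < 1 - p / d := by rw [sub_pos, div_lt_one hd]; exact hpd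
  set c₁ : ℝ := σ * 3 ^ (σ - 1) with hc₁
  have hc₁0 : 0 < c₁ := by positivity
  -- c₁ bounds the ratio of consecutive gaps, so absorbing with this η leaves the coefficient c₁η =
  -- 1/4 in front of x m.
  set η : ℝ := 1 / (4 * c₁) with hη
  have hη0 : 0 < η := by positivity
  set H : ℝ := (η⁻¹ ^ (1 / (1 - p / d))) ^ (p - 1) with hH
  have hH0 : 0 < H := by positivity
  set A₀ : ℝ := c₁ * H * C₁ ^ p * (2 ^ (σ + 1)) ^ (α * p) with hA₀
  have hA₀0 : 0 ≤ A₀ := by positivity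
  -- αp < p-1 makes the exponent of Λ negative, so a large Λ satisfies the smallness condition of
  -- `exists_le_mul_half_pow`. B ≤ Λ serves the weight bound, 1 ≤ Λ makes all gaps at least 1.
  obtain ⟨Λ, hΛB, hΛ1, hΛc⟩ : ∃ Λ : ℝ, B ≤ Λ ∧ 1 ≤ Λ ∧
      A₀ * Λ ^ (-(p - 1 - α * p)) * (C₂ * C₃) ≤ 1 / 4 := by
    have hlim : Tendsto (fun Λ : ℝ => A₀ * Λ ^ (-(p - 1 - α * p)) * (C₂ * C₃)) atTop
        (𝓝 (A₀ * 0 * (C₂ * C₃))) :=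
      ((tendsto_rpow_neg_atTop hpb).const_mul A₀).mul_const _
    rw [mul_zero, zero_mul] at hlim
    exact ((eventually_ge_atTop B).and ((eventually_ge_atTop 1).and
      (hlim.eventually (ge_mem_nhds (by norm_num : (0 : ℝ) < 1 / 4))))).exists
  have hΛ : 0 < Λ := by linarith
  set k : ℕ → ℝ := fun m => Λ * ((m : ℝ) + 1) ^ σ with hk
  have hksucc : ∀ m : ℕ, k (m + 1) = Λ * ((m : ℝ) + 1 + 1) ^ σ := fun m => by
    simp only [hk]; push_cast; rfl
  have hkpos : ∀ m, 0 < k m := fun m => by simp only [hk]; positivity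
  have hgap : ∀ m : ℕ, 1 ≤ k (m + 1) - k m := fun m => by
    have h₁ := rpow_le_sub_rpow_succ hσ1 (show (0 : ℝ) < m + 1 by positivity)
    have h₂ : (1 : ℝ) ≤ ((m : ℝ) + 1) ^ (σ - 1) :=
      Real.one_le_rpow (by linarith [(Nat.cast_nonneg m : (0 : ℝ) ≤ m)]) (by linarith)
    rw [hksucc]
    simp only [hk]
    nlinarith
  have hkmono : Monotone k := monotone_nat_of_le_succ fun m => by linarith [hgap m]
  have hktop : Tendsto k atTop atTop := by
    refine tendsto_atTop_mono (f := fun m : ℕ => (m : ℝ)) (fun m => ?_) tendsto_natCast_atTop_atTop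
    induction m with
    | zero => simpa using (hkpos 0).le
    | succ m ih => push_cast; linarith [hgap m]
  have hUm : AEMeasurable U μ := hU.1.aemeasurable
  have hW0 : ∀ x, 0 < B + U x := fun x => by linarith [hU0 x]
  have hWm : AEMeasurable (fun x => B + U x) μ := hUm.const_add B
  have hαp' : 0 < α * p' := by positivity
  have hQ : Integrable (fun x => (B + U x) ^ (α * p')) μ := by
    refine ((integrable_const (1 + B)).add hU).mono'
      (hWm.pow_const _).aestronglyMeasurable (Eventually.of_forall fun x => ?_)
    rw [Real.norm_of_nonneg (Real.rpow_nonneg (hW0 x).le _)]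
    refine (Real.rpow_le_rpow (hW0 x).le (show B + U x ≤ 1 + (B + U x) by linarith)
      hαp'.le).trans ?_
    refine (Real.rpow_le_self_of_one_le (by linarith [hW0 x]) hα1.le).trans ?_
    simp only [Pi.add_apply]
    linarith
  set P : X → ℝ := fun x => G x ^ p / (B + U x) ^ (α * p) with hPdef
  have hP0 : ∀ x, 0 ≤ P x := fun x =>
    div_nonneg (Real.rpow_nonneg (hG0 x) _) (Real.rpow_nonneg (hW0 x).le _)
  set ν : ℕ → ℝ := fun m => μ.real {x | k m ≤ U x} with hν
  have hν0 : ∀ m, 0 ≤ ν m := fun m => measureReal_nonneg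
  set e : ℕ → ℝ := fun m => ∫ x in {x | k m ≤ U x ∧ U x < k (m + 1)}, P x ∂μ with he
  have he0 : ∀ m, 0 ≤ e m := fun m => integral_nonneg hP0
  -- Level-set estimate and weighted Hölder on the strip, where B + U is at most B + k_{m+1}.
  have hbasic : ∀ m, (k (m + 1) - k m) * ν (m + 1) ^ (1 - 1 / d) ≤
      (C₁ * e m ^ (1 / p) * (B + k (m + 1)) ^ α) * ν m ^ (1 - 1 / p) := fun m => by
    have h₁ := hlevel (k m) (k (m + 1)) (hkpos m) (by linarith [hgap m])
    have h₂ := setIntegral_le_weighted_holder hpp hG hG0 hWm hW0 hP hQ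
      {x | k m ≤ U x ∧ U x < k (m + 1)}
    have hBk : 0 < B + k (m + 1) := by linarith [hkpos (m + 1)]
    have hS : NullMeasurableSet {x | k m ≤ U x ∧ U x < k (m + 1)} μ :=
      hUm.nullMeasurableSet_preimage (measurableSet_Ico (a := k m) (b := k (m + 1)))
    have h₃ : ∫ x in {x | k m ≤ U x ∧ U x < k (m + 1)}, (B + U x) ^ (α * p') ∂μ ≤
        (B + k (m + 1)) ^ (α * p') * ν m := by
      calc ∫ x in {x | k m ≤ U x ∧ U x < k (m + 1)}, (B + U x) ^ (α * p') ∂μ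
          ≤ ∫ x in {x | k m ≤ U x ∧ U x < k (m + 1)}, (B + k (m + 1)) ^ (α * p') ∂μ :=
            setIntegral_mono_on_ae₀ hQ.integrableOn (integrable_const _).integrableOn hS
              (Eventually.of_forall fun x hx =>
                Real.rpow_le_rpow (hW0 x).le (by linarith [hx.2]) hαp'.le)
        _ = (B + k (m + 1)) ^ (α * p') * μ.real {x | k m ≤ U x ∧ U x < k (m + 1)} := by
            rw [setIntegral_const, smul_eq_mul, mul_comm]
        _ ≤ (B + k (m + 1)) ^ (α * p') * ν m := by
            refine mul_le_mul_of_nonneg_left ?_ (by positivity)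
            exact measureReal_mono fun x hx => hx.1
    have h₄ : (∫ x in {x | k m ≤ U x ∧ U x < k (m + 1)}, (B + U x) ^ (α * p') ∂μ) ^ (1 / p') ≤
        (B + k (m + 1)) ^ α * ν m ^ (1 - 1 / p) := by
      refine (Real.rpow_le_rpow (integral_nonneg fun x => Real.rpow_nonneg (hW0 x).le _) h₃
        (by positivity)).trans_eq ?_
      have e₁ : α * p' * (1 / p') = α := by field_simp
      have e₂ : 1 / p' = 1 - 1 / p := by rw [hp'eq]; field_simp
      rw [Real.mul_rpow (by positivity) (hν0 m), ← Real.rpow_mul hBk.le, e₁, e₂]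
    calc (k (m + 1) - k m) * ν (m + 1) ^ (1 - 1 / d)
        ≤ C₁ * ∫ x in {x | k m ≤ U x ∧ U x < k (m + 1)}, G x ∂μ := h₁
      _ ≤ C₁ * (e m ^ (1 / p) * ((B + k (m + 1)) ^ α * ν m ^ (1 - 1 / p))) := by
          refine mul_le_mul_of_nonneg_left (h₂.trans ?_) hC₁
          exact mul_le_mul_of_nonneg_left h₄ (Real.rpow_nonneg (he0 m) _)
      _ = _ := by ring
  set x : ℕ → ℝ := fun m => (k (m + 1) - k m) * ν m ^ (1 - p / d) with hx
  have hx0 : ∀ m, 0 ≤ x m := fun m =>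
    mul_nonneg (by linarith [hgap m]) (Real.rpow_nonneg (hν0 m) _)
  have hxstep : ∀ m, x (m + 1) ≤ 1 / 4 * x m + A₀ * Λ ^ (-(p - 1 - α * p)) * e m := fun m => by
    have hg : 0 < k (m + 1) - k m := by linarith [hgap m]
    have hBk : 0 < B + k (m + 1) := by linarith [hkpos (m + 1)]
    have h₁ := rpow_le_absorb hp hpd hη0
      (mul_nonneg (mul_nonneg hC₁ (Real.rpow_nonneg (he0 m) _)) (by positivity)) hg
      (hν0 (m + 1)) (hν0 m) (hbasic m)
    rw [← hH] at h₁
    have h₂ : k (m + 1 + 1) - k (m + 1) ≤ c₁ * (k (m + 1) - k m) := by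
      have := level_gap_le hΛ hσ1 m
      rw [hksucc (m + 1), hksucc m]
      simpa only [hk, Nat.cast_add, Nat.cast_one] using this
    have h₃ : (C₁ * e m ^ (1 / p) * (B + k (m + 1)) ^ α / (k (m + 1) - k m)) ^ p =
        C₁ ^ p * e m * ((B + k (m + 1)) ^ (α * p) * (k (m + 1) - k m) ^ (-p)) := by
      rw [Real.div_rpow (by have := he0 m; positivity) hg.le,
        Real.mul_rpow (by have := he0 m; positivity) (by positivity),
        Real.mul_rpow hC₁ (Real.rpow_nonneg (he0 m) _), ← Real.rpow_mul (he0 m),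
        ← Real.rpow_mul hBk.le, one_div_mul_cancel hp0.ne', Real.rpow_one, Real.rpow_neg hg.le]
      ring
    have h₄ := level_weight_le hβ0 hβ hσ hB hΛB m
    rw [← hksucc] at h₄
    have e₁ : (k (m + 1) - k m) ^ (1 - p) = (k (m + 1) - k m) * (k (m + 1) - k m) ^ (-p) := by
      rw [sub_eq_add_neg 1 p, Real.rpow_add hg, Real.rpow_one]
    change (B + k (m + 1)) ^ (α * p) * (k (m + 1) - k m) ^ (1 - p) ≤ _ at h₄
    rw [e₁] at h₄
    rw [h₃] at h₁
    have hr0 : 0 ≤ η * ν m ^ (1 - p / d) + H * (C₁ ^ p * e m *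
        ((B + k (m + 1)) ^ (α * p) * (k (m + 1) - k m) ^ (-p))) :=
      (Real.rpow_nonneg (hν0 (m + 1)) _).trans h₁
    -- Multiplying the absorption inequality by the gap turns gap^{-p} into the gap^{1-p} of
    -- `level_weight_le`.
    calc x (m + 1) ≤ c₁ * (k (m + 1) - k m) * (η * ν m ^ (1 - p / d) + H * (C₁ ^ p * e m *
        ((B + k (m + 1)) ^ (α * p) * (k (m + 1) - k m) ^ (-p)))) :=
          mul_le_mul h₂ h₁ (Real.rpow_nonneg (hν0 _) _) (by positivity)
      _ = (c₁ * η) * x m + c₁ * H * C₁ ^ p * e m * ((B + k (m + 1)) ^ (α * p) *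
          ((k (m + 1) - k m) * (k (m + 1) - k m) ^ (-p))) := by
          simp only [hx]; ring
      _ ≤ 1 / 4 * x m + c₁ * H * C₁ ^ p * e m *
          ((2 ^ (σ + 1)) ^ (α * p) * Λ ^ (-(p - 1 - α * p))) := by
          refine add_le_add (le_of_eq ?_) (mul_le_mul_of_nonneg_left h₄ ?_)
          · congr 1
            rw [hη]; field_simp
          · have := he0 m
            positivity
      _ = _ := by rw [hA₀]; ring
  have hes : Summable e := by
    refine summable_of_sum_range_le (c := ∫ y in {y | k 0 ≤ U y}, P y ∂μ) he0 fun J => ?_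
    simpa only [add_zero] using sum_setIntegral_level_le hUm hP hP0 hkmono 0 J
  have htail : Summable x → ∀ N, ∑' m, e (m + N) ≤ (C₂ * C₃) * ∑' m, x (m + N) := by
    intro hxs N
    have h₁ : ∑' m, e (m + N) ≤ ∫ y in {y | k N ≤ U y}, P y ∂μ :=
      ((summable_nat_add_iff N).2 hes).tsum_le_of_sum_range_le fun J =>
        sum_setIntegral_level_le hUm hP hP0 hkmono N J
    have h₂ := setIntegral_level_sub_le_tsum hUm hU0 hF hF0 hFU (fun m => (hkpos m).le) hkmono
      hktop (z := fun m => C₃ * x m) (fun m => mul_nonneg hC₃ (hx0 m)) (fun m => ?_)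
      (hxs.mul_left C₃) N
    · rw [tsum_mul_left] at h₂
      calc ∑' m, e (m + N) ≤ _ := h₁
        _ ≤ _ := hmin (k N) (hkpos N)
        _ ≤ C₂ * (C₃ * ∑' m, x (m + N)) := mul_le_mul_of_nonneg_left h₂ hC₂
        _ = _ := by ring
    · calc (k (m + 1) - k m) * ∫ y in {y | k m ≤ U y}, F y ∂μ
          ≤ (k (m + 1) - k m) * (C₃ * ν m ^ (1 - p / d)) :=
            mul_le_mul_of_nonneg_left (hmar _) (by linarith [hgap m])
        _ = _ := by simp only [hx]; ring
  obtain ⟨C, hC0, hC⟩ := exists_le_mul_half_pow hx0 he0 (by positivity) hΛc hes hxstep htail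
  -- All gaps are at least 1, so ν_m^{1-p/d} ≤ x_m ≤ C 2^{-m}; taking the root gives θ.
  refine ⟨Λ, (1 / 2) ^ (1 / (1 - p / d)), C ^ (1 / (1 - p / d)), hΛ, by positivity,
    Real.rpow_lt_one (by norm_num) (by norm_num) (by positivity), by positivity, fun m => ?_⟩
  have h₁ : ν m ^ (1 - p / d) ≤ C * (1 / 2) ^ m := by
    refine le_trans ?_ (hC m)
    exact le_mul_of_one_le_left (Real.rpow_nonneg (hν0 m) _) (hgap m)
  have h₂ := Real.rpow_le_rpow (Real.rpow_nonneg (hν0 m) _) h₁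
    (by positivity : 0 ≤ 1 / (1 - p / d))
  rw [← Real.rpow_mul (hν0 m), mul_one_div_cancel hs.ne', Real.rpow_one,
    Real.mul_rpow hC0 (by positivity), ← Real.rpow_natCast, ← Real.rpow_mul (by norm_num)] at h₂
  refine h₂.trans_eq ?_
  rw [← Real.rpow_natCast, ← Real.rpow_mul (by norm_num), mul_comm (m : ℝ)]

end Decay

/-! ### From geometric decay to exponential integrability and polynomial tails. -/

section Exponential

variable {X : Type*} [MeasurableSpace X] {μ : Measure X} {U : X → ℝ}

/-- Geometric decay of the measure of the level sets `Λ (m + 1)^{1/τ}` gives exponential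
integrability of `U^τ`. -/
theorem exists_integrable_exp_of_geometric_decay [IsFiniteMeasure μ] (hU : AEMeasurable U μ)
    (hU0 : ∀ x, 0 ≤ U x) {τ Λ θ C : ℝ} (hτ : 0 < τ) (hΛ : 0 < Λ) (hθ0 : 0 < θ) (hθ1 : θ < 1)
    (hC : 0 ≤ C)
    (h : ∀ m : ℕ, μ.real {x | Λ * ((m : ℝ) + 1) ^ (1 / τ) ≤ U x} ≤ C * θ ^ m) :
    ∃ lam : ℝ, 0 < lam ∧ Integrable (fun x => Real.exp (lam * U x ^ τ)) μ := by
  have hΛτ : 0 < Λ ^ τ := Real.rpow_pos_of_pos hΛ _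
  have hlog : Real.log θ < 0 := Real.log_neg hθ0 hθ1
  -- With this choice ρ = θ^{-1/2}, hence ρθ = θ^{1/2} < 1 and the dominating series is geometric.
  set lam : ℝ := -Real.log θ / (2 * Λ ^ τ) with hlam
  have hlam0 : 0 < lam := div_pos (by linarith) (by positivity)
  set ρ : ℝ := Real.exp (lam * Λ ^ τ) with hρ
  have hρ0 : 0 < ρ := Real.exp_pos _
  have hρθ : ρ * θ < 1 := by
    have : lam * Λ ^ τ = -Real.log θ / 2 := by rw [hlam]; field_simp
    rw [hρ, this]
    nth_rewrite 2 [← Real.exp_log hθ0]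
    rw [← Real.exp_add, Real.exp_lt_one_iff]
    linarith
  have hpt : ∀ x, ENNReal.ofReal (Real.exp (lam * U x ^ τ)) ≤ ENNReal.ofReal ρ +
      ∑' m : ℕ, ENNReal.ofReal (ρ ^ (m + 2)) *
        {x | Λ * ((m : ℝ) + 1) ^ (1 / τ) ≤ U x}.indicator 1 x := fun x => by
    have hbound : ∀ s : ℝ, 0 ≤ s → U x ≤ Λ * s ^ (1 / τ) →
        Real.exp (lam * U x ^ τ) ≤ ρ ^ s := fun s hs hUs => by
      have h₁ := Real.rpow_le_rpow (hU0 x) hUs hτ.le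
      rw [Real.mul_rpow hΛ.le (Real.rpow_nonneg hs _), ← Real.rpow_mul hs,
        one_div_mul_cancel hτ.ne', Real.rpow_one] at h₁
      rw [hρ, ← Real.exp_mul]
      refine Real.exp_le_exp.2 ?_
      rw [mul_assoc]
      exact mul_le_mul_of_nonneg_left h₁ hlam0.le
    rcases lt_or_ge (U x) Λ with hx | hx
    · refine le_trans (ENNReal.ofReal_le_ofReal ?_) le_self_add
      simpa using hbound 1 zero_le_one (by simpa using hx.le)
    · refine le_trans ?_ le_add_self
      set s : ℝ := (U x / Λ) ^ τ with hs
      have hs1 : 1 ≤ s := Real.one_le_rpow ((one_le_div hΛ).2 hx) hτ.le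
      have hUs : U x = Λ * s ^ (1 / τ) := by
        rw [hs, ← Real.rpow_mul (div_nonneg (hU0 x) hΛ.le), mul_one_div_cancel hτ.ne',
          Real.rpow_one, mul_div_cancel₀ _ hΛ.ne']
      -- The levels are indexed by m + 1, so m + 1 ≤ s ≤ m + 2: x lies in the m-th level set and the
      -- exponential is at most ρ^{m+2}. A single term of the series is enough.
      obtain ⟨m, hm⟩ : ∃ m : ℕ, ⌊s⌋₊ = m + 1 :=
        Nat.exists_eq_succ_of_ne_zero (Nat.floor_pos.2 hs1).ne'
      have hm₁ : ((m : ℝ) + 1) ≤ s := by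
        have := Nat.floor_le (zero_le_one.trans hs1)
        rw [hm] at this
        exact_mod_cast this
      have hm₂ : s ≤ ((m + 2 : ℕ) : ℝ) := by
        have := Nat.lt_floor_add_one s
        rw [hm] at this
        push_cast at this ⊢
        linarith
      refine le_trans ?_ (ENNReal.le_tsum m)
      have hmem : x ∈ {x | Λ * ((m : ℝ) + 1) ^ (1 / τ) ≤ U x} := by
        change Λ * ((m : ℝ) + 1) ^ (1 / τ) ≤ U x
        rw [hUs]
        gcongr
      rw [indicator_of_mem hmem, Pi.one_apply, mul_one]
      refine ENNReal.ofReal_le_ofReal ?_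
      have := hbound ((m + 2 : ℕ) : ℝ) (by positivity) (by rw [hUs]; gcongr)
      rwa [Real.rpow_natCast] at this
  refine ⟨lam, hlam0, ?_, ?_⟩
  · exact (Real.measurable_exp.comp_aemeasurable
      ((hU.pow_const τ).const_mul lam)).aestronglyMeasurable
  rw [hasFiniteIntegral_iff_ofReal (Eventually.of_forall fun x => (Real.exp_pos _).le)]
  refine (lintegral_mono hpt).trans_lt ?_
  have hset : ∀ m : ℕ, NullMeasurableSet {x | Λ * ((m : ℝ) + 1) ^ (1 / τ) ≤ U x} μ := fun m =>
    nullMeasurableSet_level hU _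
  have hind : ∀ m : ℕ, AEMeasurable
      ({x | Λ * ((m : ℝ) + 1) ^ (1 / τ) ≤ U x}.indicator (1 : X → ℝ≥0∞)) μ := fun m =>
    measurable_one.aemeasurable.indicator₀ (hset m)
  rw [lintegral_add_left measurable_const, lintegral_const,
    lintegral_tsum fun m => (hind m).const_mul _]
  refine ENNReal.add_lt_top.2 ⟨by finiteness, ?_⟩
  have hterm : ∀ m : ℕ, ∫⁻ x, ENNReal.ofReal (ρ ^ (m + 2)) *
      {x | Λ * ((m : ℝ) + 1) ^ (1 / τ) ≤ U x}.indicator 1 x ∂μ ≤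
        ENNReal.ofReal (ρ ^ 2 * C * (ρ * θ) ^ m) := fun m => by
    rw [lintegral_const_mul'' _ (hind m),
      lintegral_indicator_one₀ (hset m), ← ofReal_measureReal,
      ← ENNReal.ofReal_mul (by positivity)]
    refine ENNReal.ofReal_le_ofReal ?_
    calc ρ ^ (m + 2) * _ ≤ ρ ^ (m + 2) * (C * θ ^ m) :=
          mul_le_mul_of_nonneg_left (h m) (by positivity)
      _ = _ := by rw [mul_pow]; ring
  refine (ENNReal.tsum_le_tsum hterm).trans_lt ?_
  rw [← ENNReal.ofReal_tsum_of_nonneg (fun m => by positivity)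
    ((summable_geometric_of_lt_one (by positivity) hρθ).mul_left _)]
  exact ENNReal.ofReal_lt_top

/-- Exponential integrability gives polynomial decay of every order of the level sets. -/
theorem exists_meas_gt_le_of_integrable_exp [IsFiniteMeasure μ] (hU : AEMeasurable U μ)
    (hU0 : ∀ x, 0 ≤ U x) {τ lam : ℝ} (hτ : 0 < τ) (hlam : 0 < lam)
    (h : Integrable (fun x => Real.exp (lam * U x ^ τ)) μ) {N : ℝ} (hN : 0 < N) :
    ∃ C : ℝ, 0 ≤ C ∧ ∀ t : ℝ, 0 < t → μ {x | t < U x} ≤ ENNReal.ofReal (C / t ^ N) := by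
  -- With y = lam U^τ, one has y^{N/τ} ≤ 1 + y^j ≤ (1 + j!) e^y, so U^N is integrable and
  -- Chebyshev's inequality applies.
  set j : ℕ := ⌈N / τ⌉₊ with hj
  set K : ℝ := (1 + j.factorial) / lam ^ (N / τ) with hK
  have hK0 : 0 < K := by positivity
  have hpt : ∀ x, U x ^ N ≤ K * Real.exp (lam * U x ^ τ) := fun x => by
    set y : ℝ := lam * U x ^ τ with hy
    have hUτ : 0 ≤ U x ^ τ := Real.rpow_nonneg (hU0 x) _
    have hy0 : 0 ≤ y := mul_nonneg hlam.le hUτ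
    have h₁ : lam ^ (N / τ) * U x ^ N = y ^ (N / τ) := by
      rw [hy, Real.mul_rpow hlam.le hUτ, ← Real.rpow_mul (hU0 x), mul_div_cancel₀ _ hτ.ne']
    have h₂ : y ^ (N / τ) ≤ 1 + y ^ j := by
      rcases le_total y 1 with h1 | h1
      · have := Real.rpow_le_one hy0 h1 (by positivity : 0 ≤ N / τ)
        have : 0 ≤ y ^ j := by positivity
        linarith
      · have := Real.rpow_le_rpow_of_exponent_le h1 (Nat.le_ceil (N / τ))
        rw [← hj, Real.rpow_natCast] at this
        linarith
    have h₃ : y ^ j ≤ j.factorial * Real.exp y := by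
      have := Real.pow_div_factorial_le_exp y hy0 j
      rwa [div_le_iff₀ (by positivity), mul_comm] at this
    have h₄ : 1 ≤ Real.exp y := Real.one_le_exp hy0
    rw [hK, div_mul_eq_mul_div, le_div_iff₀ (by positivity), mul_comm, h₁]
    linarith
  have hint : Integrable (fun x => U x ^ N) μ := by
    refine (h.const_mul K).mono' (hU.pow_const N).aestronglyMeasurable
      (Eventually.of_forall fun x => ?_)
    rw [Real.norm_of_nonneg (Real.rpow_nonneg (hU0 x) _)]
    exact hpt x
  refine ⟨∫ x, U x ^ N ∂μ, integral_nonneg fun x => Real.rpow_nonneg (hU0 x) _, fun t ht => ?_⟩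
  have hM := mul_meas_ge_le_integral_of_nonneg
    (Eventually.of_forall fun x => Real.rpow_nonneg (hU0 x) N) hint (t ^ N)
  have htN : 0 < t ^ N := Real.rpow_pos_of_pos ht _
  have hsub : μ.real {x | t < U x} ≤ μ.real {x | t ^ N ≤ U x ^ N} :=
    measureReal_mono fun x hx => Real.rpow_le_rpow ht.le (le_of_lt hx) hN.le
  rw [← ofReal_measureReal]
  refine ENNReal.ofReal_le_ofReal ?_
  rw [le_div_iff₀ htN, mul_comm]
  exact (mul_le_mul_of_nonneg_left hsub htN.le).trans hM

end Exponential

/-! ### Stampacchia's lemma. -/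

section Stampacchia

/-- **Stampacchia's lemma**: a nonincreasing function with `(h - k) ν(h)^a ≤ K ν(k)^b`, `b > a`,
vanishes at a finite level. -/
theorem exists_eq_zero_of_sub_mul_rpow_le {ν : ℝ → ℝ} (hν0 : ∀ k, 0 ≤ ν k) (hν : Antitone ν)
    {a b K k₀ : ℝ} (ha : 0 < a) (hab : a < b) (hK : 0 ≤ K)
    (h : ∀ k h, k₀ ≤ k → k < h → (h - k) * ν h ^ a ≤ K * ν k ^ b) :
    ∃ D : ℝ, 0 < D ∧ ν (k₀ + D) = 0 := by
  set γ : ℝ := b / a with hγ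
  have hγ1 : 0 < γ - 1 := by rw [hγ, sub_pos, one_lt_div ha]; exact hab
  set y : ℝ → ℝ := fun k => ν k ^ a with hy
  have hy0 : ∀ k, 0 ≤ y k := fun k => Real.rpow_nonneg (hν0 k) _
  have hyγ : ∀ k, ν k ^ b = y k ^ γ := fun k => by
    rw [hy, ← Real.rpow_mul (hν0 k), hγ, mul_div_cancel₀ _ ha.ne']
  -- For y = ν^a the recursion has powers 1 and γ > 1. Along the levels k₀ + D(1 - 2^{-m}) the gaps
  -- lose a factor 2 at each step; ρ^γ = ρ/2 compensates this exactly and keeps y ≤ y(k₀) ρ^m. The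
  -- constant D below closes the induction, its summand 1 ensuring D > 0.
  set ρ : ℝ := (1 / 2 : ℝ) ^ (1 / (γ - 1)) with hρ
  have hρ0 : 0 < ρ := by positivity
  have hρ1 : ρ < 1 := Real.rpow_lt_one (by norm_num) (by norm_num) (by positivity)
  have hργ : ρ ^ γ = ρ / 2 := by
    have : ρ ^ (γ - 1) = 1 / 2 := by
      rw [hρ, ← Real.rpow_mul (by norm_num), one_div_mul_cancel hγ1.ne', Real.rpow_one]
    calc ρ ^ γ = ρ ^ (γ - 1 + 1) := by congr 1; ring
      _ = ρ ^ (γ - 1) * ρ := Real.rpow_add_one hρ0.ne' _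
      _ = ρ / 2 := by rw [this]; ring
  set D : ℝ := 2 * K * y k₀ ^ (γ - 1) / ρ + 1 with hD
  have hD0 : 0 < D := by have := hy0 k₀; positivity
  have hstep : ∀ m : ℕ, y (k₀ + D * (1 - (1 / 2) ^ m)) ≤ y k₀ * ρ ^ m := fun m => by
    induction m with
    | zero => simp
    | succ m ih =>
      set km := k₀ + D * (1 - (1 / 2 : ℝ) ^ m) with hkm
      set km' := k₀ + D * (1 - (1 / 2 : ℝ) ^ (m + 1)) with hkm'
      have hpow : (0 : ℝ) < (1 / 2) ^ m := by positivity
      have hdiff : km' - km = D * (1 / 2) ^ m / 2 := by rw [hkm, hkm', pow_succ]; ring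
      have hpow1 : (1 / 2 : ℝ) ^ m ≤ 1 := pow_le_one₀ (by norm_num) (by norm_num)
      have hlt : km < km' := by
        rw [← sub_pos, hdiff]
        positivity
      have h₁ := h km km' (by rw [hkm]; nlinarith) hlt
      rw [hdiff, hyγ] at h₁
      have h₂ : y km ^ γ ≤ y k₀ ^ (γ - 1) * y k₀ * ((ρ / 2) ^ m) := by
        refine (Real.rpow_le_rpow (hy0 _) ih (by linarith)).trans_eq ?_
        rw [Real.mul_rpow (hy0 _) (by positivity), ← Real.rpow_natCast, ← Real.rpow_mul hρ0.le,
          mul_comm (m : ℝ), Real.rpow_mul hρ0.le, hργ, Real.rpow_natCast]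
        congr 1
        rcases (hy0 k₀).eq_or_lt with h0 | h0
        · rw [← h0, Real.zero_rpow (by linarith), mul_zero]
        · rw [← Real.rpow_add_one h0.ne']; congr 1; ring
      have h₃ : 2 * K * y k₀ ^ (γ - 1) ≤ D * ρ := by
        rw [hD, add_mul, div_mul_cancel₀ _ hρ0.ne']; linarith
      have h₄ : D * (1 / 2) ^ m / 2 * y km' ≤ D * (1 / 2) ^ m / 2 * (y k₀ * ρ ^ (m + 1)) := by
        calc D * (1 / 2) ^ m / 2 * y km' ≤ K * y km ^ γ := h₁
          _ ≤ K * (y k₀ ^ (γ - 1) * y k₀ * ((ρ / 2) ^ m)) := mul_le_mul_of_nonneg_left h₂ hK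
          _ = (2 * K * y k₀ ^ (γ - 1)) * (y k₀ * (ρ / 2) ^ m / 2) := by ring
          _ ≤ (D * ρ) * (y k₀ * (ρ / 2) ^ m / 2) :=
            mul_le_mul_of_nonneg_right h₃ (by have := hy0 k₀; positivity)
          _ = _ := by rw [div_pow, pow_succ, one_div, inv_pow]; ring
      exact le_of_mul_le_mul_left h₄ (by positivity)
  refine ⟨D, hD0, ?_⟩
  have hle : ∀ m : ℕ, y (k₀ + D) ≤ y k₀ * ρ ^ m := fun m => by
    refine le_trans ?_ (hstep m)
    refine Real.rpow_le_rpow (hν0 _) (hν ?_) ha.le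
    have : (0 : ℝ) < (1 / 2) ^ m := by positivity
    nlinarith
  have hlim : Tendsto (fun m : ℕ => y k₀ * ρ ^ m) atTop (𝓝 (y k₀ * 0)) :=
    (tendsto_pow_atTop_nhds_zero_of_lt_one hρ0.le hρ1).const_mul _
  rw [mul_zero] at hlim
  have h0 : y (k₀ + D) = 0 := le_antisymm (ge_of_tendsto' hlim hle) (hy0 _)
  exact (Real.rpow_eq_zero (hν0 _) ha.ne').1 h0

end Stampacchia

/-! ### Boundedness at supercritical integrability. -/

section Boundedness

variable {X : Type*} [MeasurableSpace X] {μ : Measure X} {U F G : X → ℝ}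

/-- The product of a function in the Marcinkiewicz space of exponent `r` and of a function in all
the Marcinkiewicz spaces belongs to the Marcinkiewicz spaces of exponent less than `r`. -/
theorem exists_meas_mul_gt_le {r s c : ℝ} (hs : 0 < s) (hsr : s < r) (hc : 0 ≤ c)
    (hU0 : ∀ x, 0 ≤ U x) (hF0 : ∀ x, 0 ≤ F x)
    (hF : ∀ t : ℝ, 0 < t → μ {x | t < F x} ≤ ENNReal.ofReal (c / t ^ r))
    (hU : ∀ N : ℝ, 0 < N → ∃ C : ℝ, 0 ≤ C ∧
      ∀ t : ℝ, 0 < t → μ {x | t < U x} ≤ ENNReal.ofReal (C / t ^ N)) :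
    ∃ C : ℝ, 0 ≤ C ∧ ∀ t : ℝ, 0 < t → μ {x | t < |F x * U x|} ≤ ENNReal.ofReal (C / t ^ s) := by
  have hr : 0 < r := hs.trans hsr
  set δ : ℝ := 1 - s / r with hδ
  have hδ0 : 0 < δ := by rw [hδ, sub_pos, div_lt_one hr]; exact hsr
  obtain ⟨C, hC0, hC⟩ := hU (s / δ) (by positivity)
  refine ⟨c + C, by positivity, fun t ht => ?_⟩
  -- Since t = t^{s/r} t^δ, a product exceeding t forces one factor to exceed its share.
  have hsub : {x | t < |F x * U x|} ⊆ {x | t ^ (s / r) < F x} ∪ {x | t ^ δ < U x} := by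
    intro x hx
    by_contra hcon
    have h₁ : F x ≤ t ^ (s / r) := not_lt.1 fun h' => hcon (Or.inl h')
    have h₂ : U x ≤ t ^ δ := not_lt.1 fun h' => hcon (Or.inr h')
    have h₃ := mul_le_mul h₁ h₂ (hU0 x) (by positivity)
    rw [← Real.rpow_add ht, hδ, add_sub_cancel, Real.rpow_one] at h₃
    have h₄ : t < |F x * U x| := hx
    rw [abs_of_nonneg (mul_nonneg (hF0 x) (hU0 x))] at h₄
    linarith
  have e₁ : (t ^ (s / r)) ^ r = t ^ s := by
    rw [← Real.rpow_mul ht.le, div_mul_cancel₀ _ hr.ne']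
  have e₂ : (t ^ δ) ^ (s / δ) = t ^ s := by
    rw [← Real.rpow_mul ht.le, mul_div_cancel₀ _ hδ0.ne']
  have h₁ := hF (t ^ (s / r)) (by positivity)
  have h₂ := hC (t ^ δ) (by positivity)
  rw [e₁] at h₁
  rw [e₂] at h₂
  refine (measure_mono hsub).trans ((measure_union_le _ _).trans ((add_le_add h₁ h₂).trans_eq ?_))
  rw [← ENNReal.ofReal_add (by positivity) (by positivity), add_div]

/-- Boundedness of a function satisfying the level set estimates of a minimum, at supercritical
integrability of the datum. -/
theorem exists_ae_le_of_level_estimates [IsFiniteMeasure μ] {d p p' α B C₁ C₂ r c : ℝ}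
    (hpp : p.HolderConjugate p') (hpd : p < d) (hα0 : 0 < α) (hα1 : α * p' < 1) (hB : 0 < B)
    (hC₁ : 0 ≤ C₁) (hC₂ : 0 ≤ C₂) (hc : 0 ≤ c) (hr : d / p < r)
    (hU : Integrable U μ) (hU0 : ∀ x, 0 ≤ U x) (hG : Integrable G μ) (hG0 : ∀ x, 0 ≤ G x)
    (hP : Integrable (fun x => G x ^ p / (B + U x) ^ (α * p)) μ)
    (hF : Integrable F μ) (hF0 : ∀ x, 0 ≤ F x)
    (hlevel : ∀ k h : ℝ, 0 < k → k < h → (h - k) * μ.real {x | h ≤ U x} ^ (1 - 1 / d) ≤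
      C₁ * ∫ x in {x | k ≤ U x ∧ U x < h}, G x ∂μ)
    (hmin : ∀ k : ℝ, 0 < k → ∫ x in {x | k ≤ U x}, G x ^ p / (B + U x) ^ (α * p) ∂μ ≤
      C₂ * ∫ x in {x | k ≤ U x}, F x * (U x - k) ∂μ)
    (hmar : ∀ t : ℝ, 0 < t → μ {x | t < F x} ≤ ENNReal.ofReal (c / t ^ r))
    (htail : ∀ N : ℝ, 0 < N → ∃ C : ℝ, 0 ≤ C ∧
      ∀ t : ℝ, 0 < t → μ {x | t < U x} ≤ ENNReal.ofReal (C / t ^ N)) :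
    ∃ L : ℝ, 0 < L ∧ ∀ᵐ x ∂μ, U x ≤ L := by
  have hp := hpp.lt
  have hp0 := hpp.pos
  have hp'0 := hpp.symm.pos
  have hd : 0 < d := hp0.trans hpd
  have hd1 : 1 < d / p := (one_lt_div hp0).2 hpd
  have hpinv : 1 / p + 1 / p' = 1 := by simpa using hpp.inv_add_inv_eq_one
  have hUm : AEMeasurable U μ := hU.1.aemeasurable
  obtain ⟨s, hs₁, hs₂⟩ := exists_between hr
  have hs1 : 1 < s := hd1.trans hs₁
  set gap : ℝ := 1 / d - 1 / (s * p) with hgap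
  have hgap0 : 0 < gap := by
    rw [hgap, sub_pos]
    refine one_div_lt_one_div_of_lt hd ?_
    rwa [div_lt_iff₀ hp0] at hs₁
  -- Hölder will produce the exponent 1 - 1/(sp) - 1/(Np'). It exceeds 1 - 1/d once 1/(Np') < gap,
  -- where gap > 0 because s > d/p.
  set N : ℝ := 1 + 1 / (p' * gap) with hN
  have hN1 : 1 < N := by
    have : 0 < 1 / (p' * gap) := by positivity
    rw [hN]
    linarith
  have hN0 : 0 < N := by linarith
  have hFUm : AEMeasurable (fun x => F x * U x) μ := hF.1.aemeasurable.mul hUm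
  obtain ⟨c', hc'0, hc'⟩ := exists_meas_mul_gt_le (by linarith) hs₂ hc hU0 hF0 hmar htail
  have hFUi : Integrable (fun x => F x * U x) μ := integrable_of_meas_gt_le hFUm hs1 hc'0 hc'
  obtain ⟨cN, hcN0, hcN⟩ := htail N hN0
  have hcN' : ∀ t : ℝ, 0 < t → μ {x | t < |U x|} ≤ ENNReal.ofReal (cN / t ^ N) := by
    simpa only [abs_of_nonneg (hU0 _)] using hcN
  have hW0 : ∀ x, 0 < B + U x := fun x => by linarith [hU0 x]
  have hWm : AEMeasurable (fun x => B + U x) μ := hUm.const_add B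
  have hαp' : 0 < α * p' := by positivity
  have hWle : ∀ x, (B + U x) ^ (α * p') ≤ (1 + B) + U x := fun x => by
    refine (Real.rpow_le_rpow (hW0 x).le (show B + U x ≤ 1 + (B + U x) by linarith)
      hαp'.le).trans ?_
    refine (Real.rpow_le_self_of_one_le (by linarith [hW0 x]) hα1.le).trans ?_
    linarith
  have hVi : Integrable (fun x => (1 + B) + U x) μ := (integrable_const (1 + B)).add hU
  have hQ : Integrable (fun x => (B + U x) ^ (α * p')) μ := by
    refine hVi.mono' (hWm.pow_const _).aestronglyMeasurable (Eventually.of_forall fun x => ?_)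
    rw [Real.norm_of_nonneg (Real.rpow_nonneg (hW0 x).le _)]
    exact hWle x
  have hP0 : ∀ x, 0 ≤ G x ^ p / (B + U x) ^ (α * p) := fun x =>
    div_nonneg (Real.rpow_nonneg (hG0 x) _) (Real.rpow_nonneg (hW0 x).le _)
  set ν : ℝ → ℝ := fun k => μ.real {x | k ≤ U x} with hν
  have hν0 : ∀ k, 0 ≤ ν k := fun k => measureReal_nonneg
  have hνanti : Antitone ν := fun k h hkh => measureReal_mono fun x hx => hkh.trans hx
  set K₁ : ℝ := C₂ * (1 + c' / (s - 1)) with hK₁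
  have hs10 : 0 < s - 1 := by linarith
  have hN10 : 0 < N - 1 := by linarith
  have hK₁0 : 0 ≤ K₁ := by positivity
  set K₂ : ℝ := (1 + B) * μ.real univ ^ (1 / N) + (1 + cN / (N - 1)) with hK₂
  have hμ0 : 0 ≤ μ.real (univ : Set X) := measureReal_nonneg
  have hK₂0 : 0 ≤ K₂ := by positivity
  have hbP : ∀ k, 0 < k → ∫ x in {x | k ≤ U x}, G x ^ p / (B + U x) ^ (α * p) ∂μ ≤
      K₁ * ν k ^ (1 - 1 / s) := fun k hk => by
    have h₁ : ∫ x in {x | k ≤ U x}, F x * (U x - k) ∂μ ≤ ∫ x in {x | k ≤ U x}, |F x * U x| ∂μ := by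
      refine integral_mono ?_ hFUi.abs.integrableOn fun x => ?_
      · simp only [mul_sub]
        exact (hFUi.sub (hF.mul_const k)).integrableOn
      · refine le_trans ?_ (le_abs_self _)
        exact mul_le_mul_of_nonneg_left (by linarith) (hF0 x)
    have h₂ := setIntegral_abs_le_of_meas_gt_le hFUm hs1 hc'0 hc' {x | k ≤ U x}
    calc _ ≤ _ := hmin k hk
      _ ≤ C₂ * ((1 + c' / (s - 1)) * ν k ^ (1 - 1 / s)) :=
        mul_le_mul_of_nonneg_left (h₁.trans h₂) hC₂
      _ = _ := by rw [hK₁]; ring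
  have hbQ : ∀ k, ∫ x in {x | k ≤ U x}, (B + U x) ^ (α * p') ∂μ ≤ K₂ * ν k ^ (1 - 1 / N) :=
      fun k => by
    have h₁ : ∫ x in {x | k ≤ U x}, (B + U x) ^ (α * p') ∂μ ≤
        ∫ x in {x | k ≤ U x}, ((1 + B) + |U x|) ∂μ := by
      refine integral_mono hQ.integrableOn ?_ fun x => ?_
      · exact ((integrable_const (1 + B)).add hU.abs).integrableOn
      · exact (hWle x).trans (by linarith [le_abs_self (U x)])
    have h₂ := setIntegral_abs_le_of_meas_gt_le hUm hN1 hcN0 hcN' {x | k ≤ U x}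
    rw [integral_add (integrable_const _) hU.abs.integrableOn, setIntegral_const, smul_eq_mul] at h₁
    have h₃ : ν k ≤ μ.real univ ^ (1 / N) * ν k ^ (1 - 1 / N) := by
      rcases (hν0 k).eq_or_lt with h0 | h0
      · rw [← h0]; positivity
      · calc ν k = ν k ^ (1 / N) * ν k ^ (1 - 1 / N) := by
              rw [← Real.rpow_add h0, add_sub_cancel, Real.rpow_one]
          _ ≤ _ := by
              gcongr
              exact measureReal_mono (subset_univ _)
    calc _ ≤ _ := h₁
      _ ≤ (μ.real univ ^ (1 / N) * ν k ^ (1 - 1 / N)) * (1 + B) +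
          (1 + cN / (N - 1)) * ν k ^ (1 - 1 / N) :=
        add_le_add (mul_le_mul_of_nonneg_right h₃ (by linarith)) h₂
      _ = _ := by rw [hK₂]; ring
  have hb : 1 - 1 / d < (1 - 1 / s) * (1 / p) + (1 - 1 / N) * (1 / p') := by
    have h₁ : 1 / N * (1 / p') < gap := by
      rw [one_div_mul_one_div, div_lt_iff₀ (by positivity), hN]
      have : gap * ((1 + 1 / (p' * gap)) * p') = gap * p' + 1 := by field_simp
      rw [this]
      have : 0 < gap * p' := by positivity
      linarith
    have h₂ : 1 / (s * p) = 1 / s * (1 / p) := (one_div_mul_one_div _ _).symm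
    have h₃ : (1 - 1 / s) * (1 / p) + (1 - 1 / N) * (1 / p') =
        (1 / p + 1 / p') - 1 / s * (1 / p) - 1 / N * (1 / p') := by ring
    rw [h₃, hpinv, ← h₂]
    linarith
  have ha : 0 < 1 - 1 / d := by
    rw [sub_pos, div_lt_one hd]; linarith
  -- The level estimates hold only for k > 0, so the iteration starts at level 1.
  obtain ⟨D, hD0, hD⟩ := exists_eq_zero_of_sub_mul_rpow_le (k₀ := 1)
    (K := C₁ * (K₁ ^ (1 / p) * K₂ ^ (1 / p'))) hν0 hνanti ha hb (by positivity)
    fun k h hk hkh => by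
      have hk0 : 0 < k := by linarith
      have h₁ := hlevel k h hk0 hkh
      have h₂ : ∫ x in {x | k ≤ U x ∧ U x < h}, G x ∂μ ≤ ∫ x in {x | k ≤ U x}, G x ∂μ :=
        setIntegral_mono_set hG.integrableOn (Eventually.of_forall hG0)
          (LE.le.eventuallyLE fun x hx => hx.1)
      have h₃ := setIntegral_le_weighted_holder hpp hG.1.aemeasurable hG0 hWm hW0 hP hQ
        {x | k ≤ U x}
      have h₄ := Real.rpow_le_rpow (integral_nonneg hP0) (hbP k hk0) (by positivity : 0 ≤ 1 / p)
      have h₅ := Real.rpow_le_rpow (integral_nonneg fun x => Real.rpow_nonneg (hW0 x).le _)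
        (hbQ k) (by positivity : 0 ≤ 1 / p')
      rw [Real.mul_rpow hK₁0 (Real.rpow_nonneg (hν0 k) _), ← Real.rpow_mul (hν0 k)] at h₄
      rw [Real.mul_rpow hK₂0 (Real.rpow_nonneg (hν0 k) _), ← Real.rpow_mul (hν0 k)] at h₅
      have hexp1 : 0 ≤ (1 - 1 / s) * (1 / p) := by
        have : 1 / s ≤ 1 := by rw [div_le_one (by linarith)]; exact hs1.le
        have : 0 ≤ 1 - 1 / s := by linarith
        positivity
      have hexp2 : 0 ≤ (1 - 1 / N) * (1 / p') := by
        have : 1 / N ≤ 1 := by rw [div_le_one hN0]; exact hN1.le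
        have : 0 ≤ 1 - 1 / N := by linarith
        positivity
      calc (h - k) * ν h ^ (1 - 1 / d) ≤ _ := h₁
        _ ≤ C₁ * ((K₁ ^ (1 / p) * ν k ^ ((1 - 1 / s) * (1 / p))) *
            (K₂ ^ (1 / p') * ν k ^ ((1 - 1 / N) * (1 / p')))) := by
          refine mul_le_mul_of_nonneg_left (h₂.trans (h₃.trans ?_)) hC₁
          exact mul_le_mul h₄ h₅ (Real.rpow_nonneg (integral_nonneg fun x =>
            Real.rpow_nonneg (hW0 x).le _) _)
            (mul_nonneg (by positivity) (Real.rpow_nonneg (hν0 k) _))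
        _ = _ := by
          rw [Real.rpow_add_of_nonneg (hν0 k) hexp1 hexp2]; ring
  refine ⟨1 + D, by linarith, ?_⟩
  have hnull : μ {x | 1 + D ≤ U x} = 0 :=
    (measureReal_eq_zero_iff (measure_ne_top _ _)).1 hD
  rw [ae_iff]
  exact measure_mono_null (fun x hx => (not_le.1 hx).le) hnull

end Boundedness

/-! ### Consequences of minimality. -/

section Minimum

/-- For t ≤ 1 the total measure is a sufficient bound; for t ≥ 1 powers of t increase with the
exponent. -/
theorem meas_gt_le_of_exponent_le {X : Type*} [MeasurableSpace X] {μ : Measure X}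
    [IsFiniteMeasure μ] {f : X → ℝ} {r s c : ℝ} (hs : 0 ≤ s) (hsr : s ≤ r) (hc : 0 ≤ c)
    (hf : ∀ t : ℝ, 0 < t → μ {x | t < |f x|} ≤ ENNReal.ofReal (c / t ^ r)) (t : ℝ) (ht : 0 < t) :
    μ {x | t < |f x|} ≤ ENNReal.ofReal ((c + μ.real univ) / t ^ s) := by
  have hμ : 0 ≤ μ.real (univ : Set X) := measureReal_nonneg
  have hts : 0 < t ^ s := Real.rpow_pos_of_pos ht s
  rcases le_total t 1 with h1 | h1
  · refine (measure_mono (subset_univ _)).trans ?_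
    rw [← ofReal_measureReal]
    refine ENNReal.ofReal_le_ofReal ?_
    rw [le_div_iff₀ hts]
    have := Real.rpow_le_one ht.le h1 hs
    nlinarith
  · refine (hf t ht).trans (ENNReal.ofReal_le_ofReal ?_)
    have := Real.rpow_le_rpow_of_exponent_le h1 hsr
    exact div_le_div₀ (by positivity) (by linarith) hts this

/-- αp' < 1 means p(1-α) > 1, so the numerator exceeds d and hence d - αp. -/
theorem one_le_sobolev_exponent {d p α : ℝ} (hp1 : 1 < p) (hpd : p < d) (hα0 : 0 < α)
    (hα1 : α * p.conjExponent < 1) : 1 ≤ d * p * (1 - α) / (d - α * p) := by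
  have hp0 : 0 < p - 1 := by linarith
  rw [Real.conjExponent, mul_div_assoc', div_lt_one hp0] at hα1
  have hα : α * p < d := by linarith
  rw [le_div_iff₀ (by linarith), one_mul]
  have h₁ : 1 ≤ p * (1 - α) := by linarith
  have h₂ : 0 < α * p := by positivity
  nlinarith

variable {n : ℕ} {Ω : Set (EuclideanSpace ℝ (Fin n))} {q : ℝ}
  {a : EuclideanSpace ℝ (Fin n) → ℝ → ℝ} {j f u : EuclideanSpace ℝ (Fin n) → ℝ}

theorem gradient_zero : gradient (0 : EuclideanSpace ℝ (Fin n) → ℝ) = 0 :=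
  gradient_const' 0

/-- A minimum has finite energy. -/
theorem IsSobolevMinimum.integrable [IsFiniteMeasure (volume.restrict Ω)] (hΩ : IsOpen Ω)
    (hq : 1 ≤ q) (hj0 : j 0 = 0) (hu : IsSobolevMinimum Ω q (extendedFunctional Ω a j f) u) :
    Integrable (fun x => a x (u x) * j (weakGradient Ω u x)) (volume.restrict Ω) ∧
      Integrable (fun x => f x * u x) (volume.restrict Ω) := by
  have h0 : IsTestLimit Ω (ENNReal.ofReal q) (0 : EuclideanSpace ℝ (Fin n) → ℝ) (gradient 0) :=
    isTestFunction_zero.isTestLimit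
  have hw := h0.weakGradient_ae_eq hΩ (ENNReal.one_le_ofReal.2 hq)
  have hle := hu.2 0 (h0.memSobolevZero hΩ hq)
  by_contra hcon
  -- Otherwise the minimum value would be ⊤, while the competitor 0 has finite energy because j(0) =
  -- 0.
  rw [extendedFunctional, if_neg hcon, top_le_iff, extendedFunctional, if_pos] at hle
  · exact EReal.coe_ne_top _ hle
  · refine ⟨(integrable_zero _ ℝ _).congr ?_, by simp⟩
    filter_upwards [hw] with x hx
    simp only [hx, gradient_zero, Pi.zero_apply, hj0, mul_zero]

/-- Comparison of a minimum with its truncations. -/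
theorem IsSobolevMinimum.setIntegral_le [IsFiniteMeasure (volume.restrict Ω)] (hΩ : IsOpen Ω)
    (hq : 1 ≤ q) (hj0 : j 0 = 0) (hf : AEMeasurable f (volume.restrict Ω))
    (hfi : Integrable f (volume.restrict Ω))
    (hu : IsSobolevMinimum Ω q (extendedFunctional Ω a j f) u) {k : ℝ} (hk : 0 < k) :
    ∫ x in {x | k ≤ |u x|}, a x (u x) * j (weakGradient Ω u x) ∂(volume.restrict Ω) ≤
      ∫ x in {x | k ≤ |u x|}, |f x| * (|u x| - k) ∂(volume.restrict Ω) := by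
  set μ := volume.restrict Ω with hμ
  have hq' : 1 ≤ ENNReal.ofReal q := ENNReal.one_le_ofReal.2 hq
  obtain ⟨hJ, hfu⟩ := hu.integrable hΩ hq hj0
  have hlim := hu.1.isTestLimit hΩ
  have hT := hlim.truncation hq' ENNReal.ofReal_ne_top hk
  have hw := hT.weakGradient_ae_eq hΩ hq'
  have hle := hu.2 _ (hT.memSobolevZero hΩ hq)
  have hum : AEMeasurable (fun x => |u x|) μ := hlim.1.1.aemeasurable.norm
  have hS : NullMeasurableSet {x | k ≤ |u x|} μ := nullMeasurableSet_level hum k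
  have hSc : {x | k ≤ |u x|}ᶜ = {x | |u x| < k} := by ext x; simp
  have hS' : NullMeasurableSet {x | |u x| < k} μ := hSc ▸ hS.compl
  set E : EuclideanSpace ℝ (Fin n) → ℝ := fun x => a x (u x) * j (weakGradient Ω u x) with hE
  have hae : (fun x => a x (truncation k (u x)) *
      j (weakGradient Ω (fun x => truncation k (u x)) x)) =ᵐ[μ] {x | |u x| < k}.indicator E := by
    filter_upwards [hw] with x hx
    rw [hx]
    by_cases hxk : |u x| < k
    · rw [indicator_of_mem (show x ∈ {x | |u x| < k} from hxk),
        indicator_of_mem (show x ∈ {x | |u x| < k} from hxk), truncation_of_abs_le hxk.le]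
    · rw [indicator_of_notMem (show x ∉ {x | |u x| < k} from hxk),
        indicator_of_notMem (show x ∉ {x | |u x| < k} from hxk), hj0, mul_zero]
  have hJT : Integrable (fun x => a x (truncation k (u x)) *
      j (weakGradient Ω (fun x => truncation k (u x)) x)) μ :=
    (hJ.indicator₀ hS').congr hae.symm
  have hfT : Integrable (fun x => f x * truncation k (u x)) μ := by
    refine hfu.mono (hf.aestronglyMeasurable.mul hT.1.1) (Eventually.of_forall fun x => ?_)
    rw [norm_mul, norm_mul]
    exact mul_le_mul_of_nonneg_left (abs_truncation_le hk.le) (norm_nonneg _)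
  rw [extendedFunctional, if_pos ⟨hJ, hfu⟩, extendedFunctional, if_pos ⟨hJT, hfT⟩,
    EReal.coe_le_coe_iff, integral_congr_ae hae, integral_indicator₀ hS'] at hle
  have hsplit := integral_add_compl₀ hS hJ
  rw [hSc] at hsplit
  -- u and T_k u agree where |u| < k and differ by |u| - k in modulus elsewhere.
  have hdiff : ∫ x, f x * u x - f x * truncation k (u x) ∂μ ≤
      ∫ x in {x | k ≤ |u x|}, |f x| * (|u x| - k) ∂μ := by
    rw [← integral_indicator₀ hS]
    refine integral_mono (hfu.sub hfT) (Integrable.indicator₀ ?_ hS) fun x => ?_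
    · have h₁ : Integrable (fun x => |f x| * |u x|) μ := by
        simpa only [abs_mul] using hfu.abs
      simp only [mul_sub]
      exact h₁.sub (hfi.abs.mul_const k)
    · beta_reduce
      rw [← mul_sub]
      by_cases hxk : k ≤ |u x|
      · rw [indicator_of_mem (show x ∈ {x | k ≤ |u x|} from hxk), ← abs_sub_truncation hk.le hxk,
          ← abs_mul]
        exact le_abs_self _
      · rw [indicator_of_notMem (show x ∉ {x | k ≤ |u x|} from hxk),
          truncation_of_abs_le (not_le.1 hxk).le, sub_self, mul_zero]
  rw [integral_sub hfu hfT] at hdiff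
  linarith

end Minimum

/-! ### The main theorem. -/

theorem theorem3p1 {n : ℕ} (hn : 2 ≤ n) (Ω : Set (EuclideanSpace ℝ (Fin n)))
    (hΩo : IsOpen Ω) (hΩb : Bornology.IsBounded Ω)
    (p α q r : ℝ) (hp1 : 1 < p) (hpn : p < n)
    (hα0 : 0 < α) (hα1 : α < 1 / p.conjExponent)
    (hq : q = n * p * (1 - α) / (n - α * p))
    (β₁ β₂ β₃ β₄ β₅ : ℝ) (hβ₁ : 0 < β₁) (hβ₂ : 0 < β₂) (hβ₄ : 0 < β₄) (hβ₅ : 0 < β₅)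
    (b : EuclideanSpace ℝ (Fin n) → ℝ) (hbm : AEMeasurable b (volume.restrict Ω))
    (hb : ∀ᵐ x ∂volume.restrict Ω, β₂ ≤ b x ∧ b x ≤ β₃)
    (a : EuclideanSpace ℝ (Fin n) → ℝ → ℝ)
    (ha : ∀ᵐ x ∂volume.restrict Ω, ∀ s : ℝ, a x s = β₁ / (b x + |s|) ^ (α * p))
    (j : EuclideanSpace ℝ (Fin n) → ℝ) (hjc : ConvexOn ℝ univ j) (hj0 : j 0 = 0)
    (hj : ∀ ξ, β₄ * ‖ξ‖ ^ p ≤ j ξ ∧ j ξ ≤ β₅ * (1 + ‖ξ‖ ^ p))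
    (f : EuclideanSpace ℝ (Fin n) → ℝ) (hf : MemMarcinkiewicz Ω r f) (hr : n / p ≤ r)
    (u : EuclideanSpace ℝ (Fin n) → ℝ)
    (hu : IsSobolevMinimum Ω q (extendedFunctional Ω a j f) u) :
    (r = n / p → ∃ lam : ℝ, 0 < lam ∧
      Integrable (fun x => Real.exp (lam * |u x| ^ (1 - α * p.conjExponent)))
        (volume.restrict Ω)) ∧
    (n / p < r → ∃ L : ℝ, 0 < L ∧ ∀ᵐ x ∂volume.restrict Ω, |u x| ≤ 2 * L) := by
  have hfin : IsFiniteMeasure (volume.restrict Ω) :=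
    isFiniteMeasure_restrict.2 hΩb.measure_lt_top.ne
  have hpp : p.HolderConjugate p.conjExponent := Real.HolderConjugate.conjExponent hp1
  have hp0 : 0 < p := hpp.pos
  have hα1' : α * p.conjExponent < 1 := by rwa [lt_div_iff₀ hpp.symm.pos] at hα1
  have hτ : 0 < 1 - α * p.conjExponent := by linarith
  have hq1 : 1 ≤ q := hq ▸ one_le_sobolev_exponent hp1 hpn hα0 hα1'
  have hq' : 1 ≤ ENNReal.ofReal q := ENNReal.one_le_ofReal.2 hq1
  have hs1 : 1 < (n : ℝ) / p := (one_lt_div hp0).2 hpn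
  obtain ⟨hfm, c, hc, hfc⟩ := hf
  have hfc' : ∀ t : ℝ, 0 < t →
      (volume.restrict Ω) {x | t < |f x|} ≤ ENNReal.ofReal (c / t ^ r) := fun t ht => by
    rw [Measure.restrict_apply' hΩo.measurableSet, inter_comm]
    exact hfc t ht
  set μ := volume.restrict Ω with hμ
  -- Lowering r to n/p makes the critical argument available in both cases; the original exponent
  -- returns only for boundedness, through `hfc'`.
  have hfs := meas_gt_le_of_exponent_le (by linarith) hr hc.le hfc'
  have hc'0 : 0 ≤ c + μ.real univ := add_nonneg hc.le measureReal_nonneg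
  have hfi : Integrable f μ := integrable_of_meas_gt_le hfm hs1 hc'0 hfs
  have hmar := setIntegral_abs_le_of_meas_gt_le hfm hs1 hc'0 hfs
  simp only [one_div_div] at hmar
  have hlim := hu.1.isTestLimit hΩo
  obtain ⟨hJ, hfu⟩ := hu.integrable hΩo hq1 hj0
  have hui : Integrable (fun x => |u x|) μ := (hlim.1.integrable hq').abs
  have hGi : Integrable (fun x => ‖weakGradient Ω u x‖) μ := (hlim.2.1.integrable hq').norm
  have hFU : Integrable (fun x => |f x| * |u x|) μ := by simpa only [abs_mul] using hfu.abs
  -- B dominates b almost everywhere; the maximum keeps it positive even when Ω is null and β₃ is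
  -- unconstrained.
  set B : ℝ := max β₃ 1 with hB
  have hB0 : 0 < B := lt_max_of_lt_right one_pos
  have hββ : 0 < β₁ * β₄ := by positivity
  have hcoer : ∀ᵐ x ∂μ, ‖weakGradient Ω u x‖ ^ p / (B + |u x|) ^ (α * p) ≤
      (β₁ * β₄)⁻¹ * (a x (u x) * j (weakGradient Ω u x)) := by
    filter_upwards [ha, hb] with x hax hbx
    have h₁ : 0 < b x + |u x| := by linarith [abs_nonneg (u x), hbx.1]
    have h₂ : b x + |u x| ≤ B + |u x| := by linarith [hbx.2, le_max_left β₃ 1]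
    have h₃ : (b x + |u x|) ^ (α * p) ≤ (B + |u x|) ^ (α * p) :=
      Real.rpow_le_rpow h₁.le h₂ (by positivity)
    have h₄ : 0 < (b x + |u x|) ^ (α * p) := Real.rpow_pos_of_pos h₁ _
    have h₅ := (hj (weakGradient Ω u x)).1
    rw [hax, inv_mul_eq_div, le_div_iff₀ hββ]
    calc ‖weakGradient Ω u x‖ ^ p / (B + |u x|) ^ (α * p) * (β₁ * β₄)
        ≤ ‖weakGradient Ω u x‖ ^ p / (b x + |u x|) ^ (α * p) * (β₁ * β₄) := by gcongr
      _ = β₁ / (b x + |u x|) ^ (α * p) * (β₄ * ‖weakGradient Ω u x‖ ^ p) := by ring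
      _ ≤ _ := mul_le_mul_of_nonneg_left h₅ (by positivity)
  have hP : Integrable (fun x => ‖weakGradient Ω u x‖ ^ p / (B + |u x|) ^ (α * p)) μ := by
    refine (hJ.const_mul (β₁ * β₄)⁻¹).mono' ?_ ?_
    · exact ((hGi.1.aemeasurable.pow_const p).div
        ((hui.1.aemeasurable.const_add B).pow_const _)).aestronglyMeasurable
    · filter_upwards [hcoer] with x hx
      rwa [Real.norm_of_nonneg (by positivity)]
  have hmin : ∀ k : ℝ, 0 < k →
      ∫ x in {x | k ≤ |u x|}, ‖weakGradient Ω u x‖ ^ p / (B + |u x|) ^ (α * p) ∂μ ≤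
        (β₁ * β₄)⁻¹ * ∫ x in {x | k ≤ |u x|}, |f x| * (|u x| - k) ∂μ := fun k hk => by
    calc _ ≤ ∫ x in {x | k ≤ |u x|}, (β₁ * β₄)⁻¹ * (a x (u x) * j (weakGradient Ω u x)) ∂μ :=
          integral_mono_ae hP.integrableOn (hJ.const_mul _).integrableOn
            (ae_restrict_of_ae hcoer)
      _ ≤ _ := by
          rw [integral_const_mul]
          exact mul_le_mul_of_nonneg_left (hu.setIntegral_le hΩo hq1 hj0 hfm hfi hk)
            (by positivity)
  obtain ⟨C₁, hC₁, hlevel⟩ := exists_levelSet_const hn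
  replace hlevel := hlevel Ω _ u _ hfin hq' ENNReal.ofReal_ne_top hlim
  have hs10 : 0 < (n : ℝ) / p - 1 := by linarith
  obtain ⟨Λ, θ, C, hΛ, hθ0, hθ1, hC, hdecay⟩ := exists_geometric_decay hpp hpn hα0 hα1' hB0 hC₁
    (by positivity) (by positivity) hui (fun x => abs_nonneg _) hGi.1.aemeasurable
    (fun x => norm_nonneg _) hP hfi.abs (fun x => abs_nonneg _) hFU hlevel hmin hmar
  obtain ⟨lam, hlam, hexp⟩ := exists_integrable_exp_of_geometric_decay hui.1.aemeasurable
    (fun x => abs_nonneg _) hτ hΛ hθ0 hθ1 hC hdecay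
  refine ⟨fun _ => ⟨lam, hlam, hexp⟩, fun hrn => ?_⟩
  -- The exponential integrability just obtained supplies the polynomial tails of |u|. The resulting
  -- bound |u| ≤ L is stronger than the required 2L.
  obtain ⟨L, hL, hae⟩ := exists_ae_le_of_level_estimates hpp hpn hα0 hα1' hB0 hC₁
    (by positivity) hc.le hrn hui (fun x => abs_nonneg _) hGi (fun x => norm_nonneg _) hP hfi.abs
    (fun x => abs_nonneg _) hlevel hmin hfc' fun N hN =>
      exists_meas_gt_le_of_integrable_exp hui.1.aemeasurable (fun x => abs_nonneg _) hτ hlam hexp hN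
  refine ⟨L, hL, ?_⟩
  filter_upwards [hae] with x hx
  linarith
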